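/- Let $p$ be a prime and let $\mathbb{C}_p$ be the completion of $\overline{\mathbb{Q}}_p$ with $|p|_p=p^{-1}$. Let $\log_p:\mathbb{C}_p^\times\to\mathbb{C}_p$ be the $p$-adic logarithm with $\log_p p=0$, i.e. the homomorphism with $\log_p p=0$ and $\log_p u=\sum_{k\ge 1}(-1)^{k+1}(u-1)^k/k$ for $|u-1|_p<1$. Let $d\geq 1$, and for a commutative ring $A$ put $L_d(A)=A[t_1^{\pm1},\dots,t_d^{\pm1}]$. If $\mathbb{Z}^d$ acts on a set $X$ such that $\mathrm{Fix}_{(n\mathbb{Z})^d}(X)$, the set of points fixed by $(n\mathbb{Z})^d$, is finite and non-empty for all $n\ge 1$ prime to $p$, the $p$-adic entropy of the action is $$h_p(X)=\lim_{\substack{n\to\infty\\ (n,p)=1}}\frac{1}{[\mathbb{Z}^d:(n\mathbb{Z})^d]}\log_p|\mathrm{Fix}_{(n\mathbb{Z})^d}(X)|\in\mathbb{C}_p,$$ if this limit exists. If $g\in L_d(\mathbb{C}_p)$ has no zero in $\mu_N^d$ for all $N\ge 1$ prime to $p$, where $\mu_N=\{z\in\mathbb{C}_p: z^N=1\}$,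 the $p$-adic Mahler measure of $g$ is $$m_p(g)=\lim_{\substack{N\to\infty\\ (N,p)=1}}\frac{1}{N^d}\sum_{\zeta\in\mu_N^d}\log_p g(\zeta),$$ if this limit exists. **Theorem.** Let $K$ be a number field with ring of integers $\mathcal{O}_K$, let $f\in L_d(\mathcal{O}_K)$, and let $N_{K/\mathbb{Q}}(f)=\prod_{\tau:K\hookrightarrow\mathbb{C}}\tau(f)\in L_d(\mathbb{Z})$, where $\tau$ is applied to the coefficients of $f$. Suppose that $N_{K/\mathbb{Q}}(f)$ has no zero on the $p$-adic torus $T_p^d=\{z\in\mathbb{C}_p^d: |z_1|_p=\dots=|z_d|_p=1\}$. Let $X_f=(L_d(\mathcal{O}_K)/fL_d(\mathcal{O}_K))^\wedge$ be the Pontryagin dual of the discrete group $L_d(\mathcal{O}_K)/fL_d(\mathcal{O}_K)$, with the $\mathbb{Z}^d$-action induced by the action $\delta\cdot\sum_\nu a_\nu t^\nu=\sum_\nu a_\nu t^{\nu+\delta}$ on $L_d(\mathcal{O}_K)$. Then the $p$-adic entropy $h_p(X_f)$ and the $p$-adic Mahler measure $m_p(N_{K/\mathbb{Q}}(f))$ exist,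 and $$h_p(X_f)=m_p(N_{K/\mathbb{Q}}(f)).$$ -/

import Mathlib

open scoped NumberField
open Filter Topology

noncomputable section

namespace PadicEntropy

/-! ### Laurent polynomials -/

/-- `L_d(R) = R[t_1^{±1}, …, t_d^{±1}]`, the group ring of `ℤ^d` over `R`;
`single ν a` is the monomial `a t^ν`. -/
abbrev Laurent (d : ℕ) (R : Type*) [CommRing R] : Type _ :=
  AddMonoidAlgebra R (Fin d → ℤ)

/-- The ring homomorphism `L_d(R) → L_d(S)` that applies `φ : R → S` to all coefficients. -/
abbrev Laurent.map (d : ℕ) {R S : Type*} [CommRing R] [CommRing S] (φ : R →+* S) :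
    Laurent d R →+* Laurent d S :=
  AddMonoidAlgebra.mapRingHom (Fin d → ℤ) φ

/-- The value `∑_ν a_ν z_1^{ν_1} ⋯ z_d^{ν_d}` of `f = ∑_ν a_ν t^ν` at a point `z` with non-zero
coordinates. -/
def Laurent.eval {d : ℕ} {F : Type*} [Field F] (f : Laurent d F) (z : Fin d → F) : F :=
  f.coeff.sum fun ν a => a * ∏ i, z i ^ ν i

/-! ### The norm `N_{K/ℚ}(f) ∈ L_d(ℤ)` -/

section Norm

variable {d : ℕ} {K : Type*} [Field K] [NumberField K]

/-- `∏_{τ : K → ℂ} τ(f) ∈ L_d(ℂ)`, over all embeddings of `K` in `ℂ`. -/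
def complexNorm (f : Laurent d (𝓞 K)) : Laurent d ℂ :=
  ∏ τ : K →+* ℂ, Laurent.map d (τ.comp (algebraMap (𝓞 K) K)) f

/-- A Laurent polynomial has integer coefficients as soon as each coefficient is an integer. -/
theorem exists_map_int_eq {S : Type*} [CommRing S] (P : Laurent d S)
    (h : ∀ ν, ∃ n : ℤ, P.coeff ν = (n : S)) :
    ∃ N : Laurent d ℤ, Laurent.map d (Int.castRingHom S) N = P := by
  choose c hc using h
  refine ⟨∑ ν ∈ P.coeff.support, AddMonoidAlgebra.single ν (c ν), ?_⟩
  rw [map_sum]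
  simp only [AddMonoidAlgebra.mapRingHom_single, eq_intCast, ← hc]
  exact P.sum_coeff_single

/-- The product of the conjugates of `f` has coefficients in `ℤ`. -/
theorem exists_intNorm (f : Laurent d (𝓞 K)) :
    ∃ N : Laurent d ℤ, Laurent.map d (Int.castRingHom ℂ) N = complexNorm f := by
  classical
  let P : Laurent d (AlgebraicClosure ℚ) := ∏ τ : K →+* (AlgebraicClosure ℚ), Laurent.map d (τ.comp (algebraMap (𝓞 K) K)) f
  have hcomp : ∀ {S T : Type} [CommRing S] [CommRing T] (φ : S →+* T) (τ : 𝓞 K →+* S),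
      Laurent.map d φ (Laurent.map d τ f) = Laurent.map d (φ.comp τ) f := by
    intro S T _ _ φ τ
    ext ν
    simp
  have hinst : (DivisionRing.toRatAlgebra : Algebra ℚ (AlgebraicClosure ℚ)) =
      AlgebraicClosure.instAlgebra ℚ := Subsingleton.elim _ _
  have halg : Algebra.IsAlgebraic ℚ (AlgebraicClosure ℚ) := by
    rw [hinst]
    exact AlgebraicClosure.isAlgebraic ℚ
  have hgal : IsGalois ℚ (AlgebraicClosure ℚ) := by
    have : IsAlgClosure ℚ (AlgebraicClosure ℚ) := ⟨inferInstance, halg⟩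
    have := IsAlgClosure.normal ℚ (AlgebraicClosure ℚ)
    exact { }
  have hfix : ∀ σ : Gal(AlgebraicClosure ℚ/ℚ), ∀ ν, σ (P.coeff ν) = P.coeff ν := by
    intro σ ν
    have h1 : Laurent.map d (σ : (AlgebraicClosure ℚ) →+* (AlgebraicClosure ℚ)) P = P := by
      simp only [P, map_prod, hcomp]
      exact Fintype.prod_equiv
        ⟨fun τ => (σ : (AlgebraicClosure ℚ) →+* (AlgebraicClosure ℚ)).comp τ, fun τ => (σ.symm : (AlgebraicClosure ℚ) →+* (AlgebraicClosure ℚ)).comp τ,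
          fun τ => by ext; simp, fun τ => by ext; simp⟩ _ _ (fun τ => rfl)
    conv_rhs => rw [← h1]
    simp
  have hint : ∀ ν, IsIntegral ℤ (P.coeff ν) := by
    intro ν
    let τ' : (K →+* (AlgebraicClosure ℚ)) → (𝓞 K →+* integralClosure ℤ (AlgebraicClosure ℚ)) := fun τ =>
      (τ.comp (algebraMap (𝓞 K) K)).codRestrict (integralClosure ℤ (AlgebraicClosure ℚ)) fun x =>
        (NumberField.RingOfIntegers.isIntegral_coe x).map τ.toIntAlgHom
    have h1 : P = Laurent.map d (algebraMap (integralClosure ℤ (AlgebraicClosure ℚ)) (AlgebraicClosure ℚ))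
        (∏ τ : K →+* (AlgebraicClosure ℚ), Laurent.map d (τ' τ) f) := by
      simp only [P, map_prod, hcomp]
      rfl
    rw [h1]
    simp only [AddMonoidAlgebra.coeff_mapRingHom]
    exact (Subtype.prop _ : _ ∈ integralClosure ℤ (AlgebraicClosure ℚ))
  have hP : ∃ N : Laurent d ℤ, Laurent.map d (Int.castRingHom (AlgebraicClosure ℚ)) N = P := by
    refine exists_map_int_eq P fun ν => ?_
    obtain ⟨q, hq⟩ := IntermediateField.mem_bot.1
      ((InfiniteGalois.mem_bot_iff_fixed (k := ℚ) (P.coeff ν)).2 fun σ => hfix σ ν)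
    have h1 : IsIntegral ℤ q := by
      have := hint ν
      rw [← hq] at this
      exact (isIntegral_algebraMap_iff (algebraMap ℚ (AlgebraicClosure ℚ)).injective).1 this
    obtain ⟨n, hn⟩ := IsIntegrallyClosed.isIntegral_iff.1 h1
    exact ⟨n, by rw [← hq, ← hn]; simp⟩
  obtain ⟨N, hN⟩ := hP
  let φ : (AlgebraicClosure ℚ) →+* ℂ := (IsAlgClosed.lift : (AlgebraicClosure ℚ) →ₐ[ℚ] ℂ)
  refine ⟨N, ?_⟩
  have h1 : Laurent.map d (Int.castRingHom ℂ) N =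
      Laurent.map d φ (Laurent.map d (Int.castRingHom (AlgebraicClosure ℚ)) N) := by
    ext ν
    simp
  have hbij : Function.Bijective (fun τ : K →+* (AlgebraicClosure ℚ) => φ.comp τ) := by
    rw [Fintype.bijective_iff_injective_and_card]
    refine ⟨fun τ τ' h => ?_, ?_⟩
    · ext x
      exact φ.injective (RingHom.congr_fun h x)
    · rw [NumberField.Embeddings.card, NumberField.Embeddings.card]
  rw [h1, hN]
  simp only [P, map_prod, hcomp, complexNorm]
  exact Fintype.prod_bijective _ hbij _ _ (fun τ => rfl)

/-- The norm `N_{K/ℚ}(f)`: the (unique) element of `L_d(ℤ)` whose image in `L_d(ℂ)` is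
`∏_{τ : K → ℂ} τ(f)`. -/
def intNorm (f : Laurent d (𝓞 K)) : Laurent d ℤ :=
  (exists_intNorm f).choose

theorem map_intNorm (f : Laurent d (𝓞 K)) :
    Laurent.map d (Int.castRingHom ℂ) (intNorm f) =
      ∏ τ : K →+* ℂ, Laurent.map d (τ.comp (algebraMap (𝓞 K) K)) f :=
  (exists_intNorm f).choose_spec

end Norm

/-! ### The `p`-adic logarithm with `log_p p = 0` -/

section Log

variable (p : ℕ) [Fact p.Prime]

/-- The logarithm series `log u = ∑_{k ≥ 1} (-1)^{k+1} (u - 1)^k / k`, convergent for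
`‖u - 1‖ < 1`. -/
def logSeries (u : ℂ_[p]) : ℂ_[p] :=
  ∑' k : ℕ, (-1) ^ k * (u - 1) ^ (k + 1) / ((k : ℂ_[p]) + 1)

open Classical in
/-- The `p`-adic logarithm `log_p` on `ℂ_p^×` with `log_p p = 0`. For every `z ≠ 0` there are
`n ≥ 1` and `a ∈ ℤ` such that `u = z^n p^a` satisfies `‖u - 1‖ < 1`, and then
`log_p z = (1/n) log u`; the value does not depend on `(n, a)`.
(No such pair exists for `z = 0`, where the value is the irrelevant `0`.) -/
def log (z : ℂ_[p]) : ℂ_[p] :=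
  if h : ∃ q : ℕ × ℤ, 0 < q.1 ∧ ‖z ^ q.1 * (p : ℂ_[p]) ^ q.2 - 1‖ < 1 then
    (h.choose.1 : ℂ_[p])⁻¹ * logSeries p (z ^ h.choose.1 * (p : ℂ_[p]) ^ h.choose.2)
  else 0

end Log

/-! ### `p`-adic entropy and `p`-adic Mahler measure -/

/-- The filter of `n → ∞` through the integers `n` prime to `p`. -/
def primeToAtTop (p : ℕ) : Filter ℕ := atTop ⊓ 𝓟 {n | n.Coprime p}

/-- The subgroup `(nℤ)^d` of `ℤ^d`. -/
def lattice (d n : ℕ) : AddSubgroup (Fin d → ℤ) where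
  carrier := {v | ∀ i, (n : ℤ) ∣ v i}
  zero_mem' := fun _ => dvd_zero _
  add_mem' := fun ha hb i => dvd_add (ha i) (hb i)
  neg_mem' := fun ha i => (dvd_neg).2 (ha i)

/-- The `p`-adic entropy `h_p(X)` of an action of `ℤ^d` on a set `X` exists and equals `h`:
the fixed point sets of `(nℤ)^d` are finite and non-empty for all `n` prime to `p`
(so that `log_p |Fix|` makes sense), and
`[ℤ^d : (nℤ)^d]⁻¹ log_p |Fix_{(nℤ)^d}(X)| → h` as `n → ∞`, `(n, p) = 1`. -/
structure HasEntropy (p : ℕ) [Fact p.Prime] (d : ℕ) (X : Type*) [AddAction (Fin d → ℤ) X]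
    (h : ℂ_[p]) : Prop where
  finite : ∀ n : ℕ, n.Coprime p → (AddAction.fixedPoints (lattice d n) X).Finite
  nonempty : ∀ n : ℕ, n.Coprime p → (AddAction.fixedPoints (lattice d n) X).Nonempty
  tendsto : Tendsto
    (fun n : ℕ => ((lattice d n).index : ℂ_[p])⁻¹ *
      log p ((AddAction.fixedPoints (lattice d n) X).ncard : ℂ_[p]))
    (primeToAtTop p) (𝓝 h)

/-- The finite set `μ_N^d` of all `ζ ∈ ℂ_p^d` with `ζ_i^N = 1` for all `i` (for `N ≥ 1`). -/
def rootsTorus (p : ℕ) [Fact p.Prime] (d N : ℕ) : Finset (Fin d → ℂ_[p]) :=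
  Fintype.piFinset fun _ => Polynomial.nthRootsFinset N (1 : ℂ_[p])

/-- The `p`-adic Mahler measure `m_p(f)` of `f ∈ L_d(ℂ_p)` exists and equals `m`:
`f` has no zero in `μ_N^d` for `N` prime to `p` (so that `log_p f(ζ)` makes sense), and
`N^{-d} ∑_{ζ ∈ μ_N^d} log_p f(ζ) → m` as `N → ∞`, `(N, p) = 1`. -/
structure HasMahlerMeasure (p : ℕ) [Fact p.Prime] (d : ℕ) (f : Laurent d ℂ_[p])
    (m : ℂ_[p]) : Prop where
  ne_zero : ∀ N : ℕ, N.Coprime p → ∀ ζ ∈ rootsTorus p d N, f.eval ζ ≠ 0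
  tendsto : Tendsto
    (fun N : ℕ => ((N : ℂ_[p]) ^ d)⁻¹ * ∑ ζ ∈ rootsTorus p d N, log p (f.eval ζ))
    (primeToAtTop p) (𝓝 m)

/-- The `p`-adic torus `T_p^d = {z ∈ ℂ_p^d : |z_1|_p = ⋯ = |z_d|_p = 1}`. -/
def torus (p : ℕ) [Fact p.Prime] (d : ℕ) : Set (Fin d → ℂ_[p]) :=
  {z | ∀ i, ‖z i‖ = 1}

/-! ### The dynamical system `X_f` -/

section System

variable {d : ℕ} {R : Type*} [CommRing R]

/-- `L_d(R) / f L_d(R)`, as a discrete abelian group. -/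
def CyclicModule (f : Laurent d R) : Type _ :=
  Laurent d R ⧸ Ideal.span {f}

instance (f : Laurent d R) : CommRing (CyclicModule f) :=
  inferInstanceAs (CommRing (Laurent d R ⧸ Ideal.span {f}))

instance (f : Laurent d R) : TopologicalSpace (CyclicModule f) := ⊥

instance (f : Laurent d R) : DiscreteTopology (CyclicModule f) := ⟨rfl⟩

/-- The class of the monomial `t^δ`. Multiplication by it is the automorphism of
`L_d(R) / f L_d(R)` induced by `∑ a_ν t^ν ↦ ∑ a_ν t^{ν + δ}`. -/
def monomialClass (f : Laurent d R) (δ : Fin d → ℤ) : CyclicModule f :=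
  Ideal.Quotient.mk (Ideal.span {f}) (AddMonoidAlgebra.single δ 1)

theorem single_mul_eq_shift (g : Laurent d R) (δ : Fin d → ℤ) :
    AddMonoidAlgebra.single δ 1 * g =
      g.coeff.sum fun ν a => AddMonoidAlgebra.single (ν + δ) a := by
  conv_lhs => rw [← g.sum_coeff_single]
  simp [Finsupp.sum, Finset.mul_sum, AddMonoidAlgebra.single_mul_single, add_comm]

theorem monomialClass_zero (f : Laurent d R) : monomialClass f 0 = 1 := rfl

theorem monomialClass_add (f : Laurent d R) (δ ε : Fin d → ℤ) :
    monomialClass f (δ + ε) = monomialClass f δ * monomialClass f ε := by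
  have h : (AddMonoidAlgebra.single (δ + ε) 1 : Laurent d R) =
      AddMonoidAlgebra.single δ 1 * AddMonoidAlgebra.single ε 1 := by
    simp [AddMonoidAlgebra.single_mul_single]
  exact (congrArg (Ideal.Quotient.mk (Ideal.span {f})) h).trans (map_mul _ _ _)

/-- `X_f = (L_d(R) / f L_d(R))^∧`, the Pontryagin dual (the additive group is written
multiplicatively, as `PontryaginDual` expects). -/
abbrev DualSystem (f : Laurent d R) : Type _ :=
  PontryaginDual (Multiplicative (CyclicModule f))

/-- Multiplication by `t^δ` on `L_d(R) / f L_d(R)`, as a continuous homomorphism. -/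
def shift (f : Laurent d R) (δ : Fin d → ℤ) :
    Multiplicative (CyclicModule f) →ₜ* Multiplicative (CyclicModule f) where
  toMonoidHom := (AddMonoidHom.mulLeft (monomialClass f δ)).toMultiplicative
  continuous_toFun := continuous_of_discreteTopology

theorem shift_apply (f : Laurent d R) (δ : Fin d → ℤ) (m : Multiplicative (CyclicModule f)) :
    shift f δ m = Multiplicative.ofAdd (monomialClass f δ * m.toAdd) := rfl

/-- The action of `ℤ^d` on `X_f` dual to the action on `L_d(R) / f L_d(R)`:
`(δ · χ)(m) = χ(t^δ m)`. -/
instance (f : Laurent d R) : AddAction (Fin d → ℤ) (DualSystem f) where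
  vadd δ χ := PontryaginDual.map (shift f δ) χ
  zero_vadd χ := PontryaginDual.ext fun m => congrArg χ <| by
    change shift f 0 m = m
    rw [shift_apply, monomialClass_zero, one_mul, ofAdd_toAdd]
  add_vadd δ ε χ := PontryaginDual.ext fun m => congrArg χ <| by
    change shift f (δ + ε) m = shift f ε (shift f δ m)
    rw [shift_apply, shift_apply, shift_apply, toAdd_ofAdd, ← mul_assoc, ← monomialClass_add,
      add_comm ε δ]

theorem vadd_apply (f : Laurent d R) (δ : Fin d → ℤ) (χ : DualSystem f)
    (m : Multiplicative (CyclicModule f)) :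
    (δ +ᵥ χ) m = χ (Multiplicative.ofAdd (monomialClass f δ * m.toAdd)) := rfl

end System

end PadicEntropy

end

/-! For each `n` prime to `p`, the `n`-th terms of the two limits are equal, so only one limit has
to be shown to exist. By Pontryagin duality, the points of `X_f` fixed by `(nℤ)^d` are the
characters of `𝓞_K[(ℤ/n)^d] / f` (`range_pullback`). When finite, this group has as many characters
as elements, namely the absolute value of the norm over `ℤ` of the image of `f`
(`natCard_quotient_span_singleton`). The characters of `(ℤ/n)^d` diagonalise the group algebra, so
this norm is the product of the values of `N_{K/ℚ}(f)` over `μ_n^d` (`norm_groupAlgebra`,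
`norm_reduceHom_ringOfIntegers`). It is nonzero because `μ_n^d` lies in the torus, and `log_p` turns
the product into a sum and ignores the sign.

For convergence, a Laurent polynomial without zeros on the torus has a strictly dominant coefficient
`a`, so it is `a t^ν (1 + g)` with `|g| ≤ r < 1` on the torus (`exists_eq_single_mul`). At a tuple
of roots of unity the monomial `t^ν` contributes nothing to `log_p`, leaving `log a + log (1 + g)`.
In the expansion of the second term, the average of `g^k` over `μ_N^d` is the constant term of `g^k`
once `N` is large. Since `|N|_p = 1`, averaging does not enlarge norms, and dominated convergence
gives the limit.

Additivity of `log` is needed only on `LogDomain`, which contains the roots of unity, the disc `|u -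
1| < 1` and the nonzero integers. -/

noncomputable section

namespace PadicEntropy

/-! ### Additivity of the `p`-adic logarithm -/

section Log

variable {p : ℕ} [Fact p.Prime]

theorem norm_natCast_eq (n : ℕ) : ‖(n : ℂ_[p])‖ = ‖(n : ℚ_[p])‖ := by
  rw [← map_natCast (algebraMap ℚ_[p] ℂ_[p]), norm_algebraMap']

theorem norm_intCast_eq (n : ℤ) : ‖(n : ℂ_[p])‖ = ‖(n : ℚ_[p])‖ := by
  rw [← map_intCast (algebraMap ℚ_[p] ℂ_[p]), norm_algebraMap']

theorem norm_natCast_le_one (n : ℕ) : ‖(n : ℂ_[p])‖ ≤ 1 := by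
  rw [norm_natCast_eq]
  exact_mod_cast Padic.norm_int_le_one (p := p) n

theorem norm_inv_natCast_le {n : ℕ} (hn : n ≠ 0) : ‖(n : ℂ_[p])‖⁻¹ ≤ n := by
  rw [norm_natCast_eq, Padic.norm_eq_zpow_neg_valuation (by exact_mod_cast hn),
    Padic.valuation_natCast, zpow_neg, inv_inv, zpow_natCast]
  exact_mod_cast Nat.le_of_dvd (Nat.pos_of_ne_zero hn) pow_padicValNat_dvd

theorem norm_prime_cast_lt_one : ‖(p : ℂ_[p])‖ < 1 := by
  rw [norm_natCast_eq]
  exact Padic.norm_p_lt_one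

theorem prime_cast_ne_zero : (p : ℂ_[p]) ≠ 0 :=
  Nat.cast_ne_zero.2 (Fact.out : p.Prime).ne_zero

theorem tendsto_prime_pow : Tendsto (fun n : ℕ => (p : ℂ_[p]) ^ n) atTop (𝓝 0) :=
  tendsto_pow_atTop_nhds_zero_of_norm_lt_one norm_prime_cast_lt_one

theorem choose_succ_eq (m k : ℕ) :
    ((m + 1).choose (k + 1) : ℂ_[p]) = (m + 1) * m.choose k / (k + 1) := by
  rw [eq_div_iff (by exact_mod_cast k.succ_ne_zero)]
  exact_mod_cast (Nat.add_one_mul_choose_eq m k).symm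

/-- By Pascal's rule the binomials with lower index `k` and `k + 1` sum to `C(pⁿ, k+1) = pⁿ/(k+1) ·
C(pⁿ - 1, k)`, which tends to `0`; each increase of `k` therefore flips the sign of the limit. -/
theorem tendsto_choose (k : ℕ) :
    Tendsto (fun n : ℕ => ((p ^ n - 1).choose k : ℂ_[p])) atTop (𝓝 ((-1) ^ k)) := by
  have hp : ∀ n, p ^ n - 1 + 1 = p ^ n := fun n =>
    Nat.sub_add_cancel (Nat.one_le_pow _ _ (Fact.out : p.Prime).pos)
  induction k with
  | zero => simp
  | succ k ih =>
    have h1 : Tendsto (fun n : ℕ => ((p ^ n).choose (k + 1) : ℂ_[p])) atTop (𝓝 0) := by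
      have : ∀ n, ((p ^ n).choose (k + 1) : ℂ_[p]) =
          (p : ℂ_[p]) ^ n * (p ^ n - 1).choose k / (k + 1) := fun n => by
        conv_lhs => rw [← hp n, choose_succ_eq]
        congr 2
        exact_mod_cast hp n
      simp only [this]
      simpa using (tendsto_prime_pow.mul ih).div_const ((k : ℂ_[p]) + 1)
    have h2 : ∀ n, ((p ^ n - 1).choose (k + 1) : ℂ_[p]) =
        (p ^ n).choose (k + 1) - (p ^ n - 1).choose k := fun n => by
      conv_rhs => rw [← hp n, Nat.choose_succ_succ, Nat.add_sub_cancel]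
      push_cast
      ring
    simp only [h2]
    convert! h1.sub ih using 2
    ring

/-- The common dominating bound: `c` is a binomial coefficient in the limit formula for the
logarithm and a sign in the logarithm series. -/
theorem norm_logTerm_le {x : ℂ_[p]} {r : ℝ} (hr : ‖x‖ ≤ r) (k : ℕ) {c : ℂ_[p]} (hc : ‖c‖ ≤ 1) :
    ‖c * x ^ (k + 1) / ((k : ℂ_[p]) + 1)‖ ≤ ((k : ℝ) + 1) * r ^ (k + 1) := by
  have h1 : ‖((k : ℂ_[p]) + 1)‖⁻¹ ≤ (k : ℝ) + 1 := by
    exact_mod_cast norm_inv_natCast_le (p := p) k.succ_ne_zero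
  rw [norm_div, norm_mul, norm_pow, div_eq_mul_inv, mul_comm]
  refine mul_le_mul h1 ?_ (by positivity) (by positivity)
  calc ‖c‖ * ‖x‖ ^ (k + 1) ≤ 1 * r ^ (k + 1) := by gcongr
    _ = _ := one_mul _

theorem summable_logBound {r : ℝ} (h0 : 0 ≤ r) (h1 : r < 1) :
    Summable fun k : ℕ => ((k : ℝ) + 1) * r ^ (k + 1) := by
  have := summable_pow_mul_geometric_of_norm_lt_one 1 (r := r) (by rwa [Real.norm_of_nonneg h0])
  have h2 := (summable_nat_add_iff 1).2 this
  simpa using h2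

theorem pow_sub_one_div_eq_tsum (x : ℂ_[p]) (m : ℕ) :
    ((1 + x) ^ (m + 1) - 1) / ((m : ℂ_[p]) + 1) =
      ∑' k : ℕ, (m.choose k : ℂ_[p]) * x ^ (k + 1) / ((k : ℂ_[p]) + 1) := by
  have hm : (m : ℂ_[p]) + 1 ≠ 0 := by exact_mod_cast m.succ_ne_zero
  rw [tsum_eq_sum (s := Finset.range (m + 1)) fun k hk => by
    rw [Nat.choose_eq_zero_of_lt (by simpa [Nat.lt_succ_iff] using hk)]; simp]
  rw [add_comm 1 x, add_pow, Finset.sum_range_succ', div_eq_iff hm, Finset.sum_mul]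
  simp only [one_pow, mul_one, pow_zero, Nat.choose_zero_right, Nat.cast_one, add_sub_cancel_right]
  refine Finset.sum_congr rfl fun k _ => ?_
  rw [choose_succ_eq]
  ring

/-- The logarithm as the limit of `(u ^ pⁿ - 1) / pⁿ`. -/
theorem tendsto_logSeries {u : ℂ_[p]} (hu : ‖u - 1‖ < 1) :
    Tendsto (fun n : ℕ => (u ^ p ^ n - 1) / (p : ℂ_[p]) ^ n) atTop (𝓝 (logSeries p u)) := by
  have hp : ∀ n, p ^ n - 1 + 1 = p ^ n := fun n =>
    Nat.sub_add_cancel (Nat.one_le_pow _ _ (Fact.out : p.Prime).pos)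
  have h1 : ∀ n : ℕ, (u ^ p ^ n - 1) / (p : ℂ_[p]) ^ n =
      ∑' k : ℕ, ((p ^ n - 1).choose k : ℂ_[p]) * (u - 1) ^ (k + 1) / ((k : ℂ_[p]) + 1) := by
    intro n
    rw [← pow_sub_one_div_eq_tsum, hp, add_sub_cancel]
    congr 1
    exact_mod_cast (hp n).symm
  simp only [h1]
  -- The binomial expansion turns into the logarithm series term by term, under a bound independent
  -- of `n`.
  refine tendsto_tsum_of_dominated_convergence (summable_logBound (norm_nonneg _) hu)
    (fun k => ?_) (Eventually.of_forall fun n k => norm_logTerm_le le_rfl k (norm_natCast_le_one _))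
  exact ((tendsto_choose k).mul_const _).div_const _

theorem norm_mul_sub_one_lt {u v : ℂ_[p]} (hu : ‖u - 1‖ < 1) (hv : ‖v - 1‖ < 1) :
    ‖u * v - 1‖ < 1 := by
  have h : u * v - 1 = (u - 1) * (v - 1) + ((u - 1) + (v - 1)) := by ring
  have h1 : ‖(u - 1) * (v - 1)‖ < 1 := by
    rw [norm_mul]
    exact mul_lt_one_of_nonneg_of_lt_one_left (norm_nonneg _) hu hv.le
  rw [h]
  exact (IsUltrametricDist.norm_add_le_max _ _).trans_lt
    (max_lt h1 ((IsUltrametricDist.norm_add_le_max _ _).trans_lt (max_lt hu hv)))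

theorem norm_pow_sub_one_lt {u : ℂ_[p]} (hu : ‖u - 1‖ < 1) (n : ℕ) : ‖u ^ n - 1‖ < 1 := by
  induction n with
  | zero => simp
  | succ n ih => rw [pow_succ]; exact norm_mul_sub_one_lt ih hu

theorem norm_eq_one_of_sub_one_lt {u : ℂ_[p]} (hu : ‖u - 1‖ < 1) : ‖u‖ = 1 := by
  have h := IsUltrametricDist.norm_add_eq_max_of_norm_ne_norm (x := u - 1) (y := 1)
    (by rw [norm_one]; exact hu.ne)
  rwa [sub_add_cancel, norm_one, max_eq_right hu.le] at h

/-- With `A` and `B` the `n`-th approximants `(u^(pⁿ) - 1)/pⁿ` and `(v^(pⁿ) - 1)/pⁿ`, the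
approximant of `uv` is `pⁿAB + A + B`, and the product term vanishes in the limit. -/
theorem logSeries_mul {u v : ℂ_[p]} (hu : ‖u - 1‖ < 1) (hv : ‖v - 1‖ < 1) :
    logSeries p (u * v) = logSeries p u + logSeries p v := by
  refine tendsto_nhds_unique (tendsto_logSeries (norm_mul_sub_one_lt hu hv)) ?_
  have h1 := tendsto_logSeries hu
  have h2 := tendsto_logSeries hv
  have h3 := (tendsto_prime_pow.mul (h1.mul h2)).add (h1.add h2)
  rw [zero_mul, zero_add] at h3
  refine h3.congr fun n => ?_
  have : (p : ℂ_[p]) ^ n ≠ 0 := pow_ne_zero _ prime_cast_ne_zero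
  field_simp
  ring

theorem logSeries_one : logSeries p 1 = 0 := by
  simp [logSeries]

theorem logSeries_pow {u : ℂ_[p]} (hu : ‖u - 1‖ < 1) (n : ℕ) :
    logSeries p (u ^ n) = n * logSeries p u := by
  induction n with
  | zero => simp [logSeries_one]
  | succ n ih =>
    rw [pow_succ, logSeries_mul (norm_pow_sub_one_lt hu n) hu, ih]
    push_cast
    ring

/-- The elements some power of which lies, up to a power of `p`, in the disc of convergence of the
logarithm series. -/
def LogDomain (p : ℕ) [Fact p.Prime] (z : ℂ_[p]) : Prop :=
  ∃ q : ℕ × ℤ, 0 < q.1 ∧ ‖z ^ q.1 * (p : ℂ_[p]) ^ q.2 - 1‖ < 1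

theorem log_eq {z : ℂ_[p]} {n : ℕ} {a : ℤ} (hn : 0 < n)
    (h : ‖z ^ n * (p : ℂ_[p]) ^ a - 1‖ < 1) :
    log p z = (n : ℂ_[p])⁻¹ * logSeries p (z ^ n * (p : ℂ_[p]) ^ a) := by
  have hex : ∃ q : ℕ × ℤ, 0 < q.1 ∧ ‖z ^ q.1 * (p : ℂ_[p]) ^ q.2 - 1‖ < 1 := ⟨(n, a), hn, h⟩
  rw [log, dif_pos hex]
  obtain ⟨hm, h'⟩ := hex.choose_spec
  generalize hex.choose.1 = m at hm h' ⊢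
  generalize hex.choose.2 = b at h' ⊢
  have hp0 : (p : ℂ_[p]) ≠ 0 := prime_cast_ne_zero
  have hu : (z ^ n * (p : ℂ_[p]) ^ a) ^ m = z ^ (n * m) * (p : ℂ_[p]) ^ (a * m) := by
    rw [mul_pow, ← pow_mul, zpow_mul, zpow_natCast]
  have hv : (z ^ m * (p : ℂ_[p]) ^ b) ^ n = z ^ (n * m) * (p : ℂ_[p]) ^ (b * n) := by
    rw [mul_pow, ← pow_mul, zpow_mul, zpow_natCast, mul_comm m n]
  have nu := norm_eq_one_of_sub_one_lt (norm_pow_sub_one_lt h m)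
  have nv := norm_eq_one_of_sub_one_lt (norm_pow_sub_one_lt h' n)
  rw [hu, norm_mul, norm_zpow] at nu
  rw [hv, norm_mul, norm_zpow] at nv
  have hz : ‖z ^ (n * m)‖ ≠ 0 := fun h0 => by simp [h0] at nu
  -- Both powers have norm `1` and share the factor `z^(nm)`, so the powers of `p` have equal norm
  -- and hence equal exponent. This makes the logarithm independent of the chosen pair.
  have hab : a * m = b * n :=
    zpow_right_injective₀ (norm_pos_iff.2 hp0) norm_prime_cast_lt_one.ne
      (mul_left_cancel₀ hz (nu.trans nv.symm))
  have key : (m : ℂ_[p]) * logSeries p (z ^ n * (p : ℂ_[p]) ^ a) =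
      n * logSeries p (z ^ m * (p : ℂ_[p]) ^ b) := by
    rw [← logSeries_pow h, ← logSeries_pow h', hu, hv, hab]
  have hm0 : (m : ℂ_[p]) ≠ 0 := Nat.cast_ne_zero.2 hm.ne'
  have hn0 : (n : ℂ_[p]) ≠ 0 := Nat.cast_ne_zero.2 hn.ne'
  rw [inv_mul_eq_iff_eq_mul₀ hm0, mul_left_comm, key, inv_mul_cancel_left₀ hn0]

theorem LogDomain.of_norm_sub_one_lt {u : ℂ_[p]} (hu : ‖u - 1‖ < 1) : LogDomain p u :=
  ⟨(1, 0), one_pos, by simpa using hu⟩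

theorem log_eq_logSeries {u : ℂ_[p]} (hu : ‖u - 1‖ < 1) : log p u = logSeries p u := by
  simpa using log_eq (z := u) (n := 1) (a := 0) one_pos (by simpa using hu)

theorem LogDomain.of_pow_eq_one {z : ℂ_[p]} {n : ℕ} (hn : 0 < n) (h : z ^ n = 1) :
    LogDomain p z :=
  ⟨(n, 0), hn, by simp [h]⟩

theorem log_of_pow_eq_one {z : ℂ_[p]} {n : ℕ} (hn : 0 < n) (h : z ^ n = 1) : log p z = 0 := by
  rw [log_eq hn (a := 0) (by simp [h])]
  simp [h, logSeries_one]

theorem logDomain_mul_and_log {z w : ℂ_[p]} (hz : LogDomain p z) (hw : LogDomain p w) :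
    LogDomain p (z * w) ∧ log p (z * w) = log p z + log p w := by
  obtain ⟨⟨n, a⟩, hn, hu⟩ := hz
  obtain ⟨⟨m, b⟩, hm, hv⟩ := hw
  dsimp only at hn hu hm hv
  have hp0 : (p : ℂ_[p]) ≠ 0 := prime_cast_ne_zero
  have key : (z * w) ^ (n * m) * (p : ℂ_[p]) ^ (a * m + b * n) =
      (z ^ n * (p : ℂ_[p]) ^ a) ^ m * (w ^ m * (p : ℂ_[p]) ^ b) ^ n := by
    rw [zpow_add₀ hp0, zpow_mul, zpow_mul, zpow_natCast, zpow_natCast]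
    ring
  have hum := norm_pow_sub_one_lt hu m
  have hvn := norm_pow_sub_one_lt hv n
  have hd : ‖(z * w) ^ (n * m) * (p : ℂ_[p]) ^ (a * m + b * n) - 1‖ < 1 := by
    rw [key]
    exact norm_mul_sub_one_lt hum hvn
  refine ⟨⟨(n * m, a * m + b * n), Nat.mul_pos hn hm, hd⟩, ?_⟩
  rw [log_eq (Nat.mul_pos hn hm) hd, log_eq hn hu, log_eq hm hv, key, logSeries_mul hum hvn,
    logSeries_pow hu, logSeries_pow hv]
  have hm0 : (m : ℂ_[p]) ≠ 0 := Nat.cast_ne_zero.2 hm.ne'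
  have hn0 : (n : ℂ_[p]) ≠ 0 := Nat.cast_ne_zero.2 hn.ne'
  push_cast
  field_simp

theorem LogDomain.mul {z w : ℂ_[p]} (hz : LogDomain p z) (hw : LogDomain p w) :
    LogDomain p (z * w) :=
  (logDomain_mul_and_log hz hw).1

theorem log_mul {z w : ℂ_[p]} (hz : LogDomain p z) (hw : LogDomain p w) :
    log p (z * w) = log p z + log p w :=
  (logDomain_mul_and_log hz hw).2

theorem LogDomain.one : LogDomain p 1 := .of_pow_eq_one one_pos (one_pow 1)

theorem LogDomain.pow {z : ℂ_[p]} (hz : LogDomain p z) (n : ℕ) : LogDomain p (z ^ n) := by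
  induction n with
  | zero => simpa using LogDomain.one
  | succ n ih => rw [pow_succ]; exact ih.mul hz

theorem LogDomain.prod {ι : Type*} {s : Finset ι} {z : ι → ℂ_[p]}
    (h : ∀ i ∈ s, LogDomain p (z i)) : LogDomain p (∏ i ∈ s, z i) :=
  Finset.prod_induction _ (LogDomain p) (fun _ _ => .mul) .one h

theorem log_prod {ι : Type*} {s : Finset ι} {z : ι → ℂ_[p]} (h : ∀ i ∈ s, LogDomain p (z i)) :
    log p (∏ i ∈ s, z i) = ∑ i ∈ s, log p (z i) := by
  classical
  induction s using Finset.induction_on with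
  | empty => simpa using log_of_pow_eq_one (p := p) one_pos (one_pow 1)
  | insert i s hi ih =>
    rw [Finset.prod_insert hi, Finset.sum_insert hi, log_mul (h i (Finset.mem_insert_self i s))
      (.prod fun j hj => h j (Finset.mem_insert_of_mem hj)),
      ih fun j hj => h j (Finset.mem_insert_of_mem hj)]

theorem log_neg {z : ℂ_[p]} (hz : LogDomain p z) : log p (-z) = log p z := by
  have h : (-1 : ℂ_[p]) ^ 2 = 1 := by norm_num
  rw [← neg_one_mul, log_mul (.of_pow_eq_one two_pos h) hz, log_of_pow_eq_one two_pos h, zero_add]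

theorem LogDomain.prime : LogDomain p (p : ℂ_[p]) :=
  ⟨(1, -1), one_pos, by simp⟩

/-- After the powers of `p` are split off, Fermat's little theorem puts the `(p - 1)`-st power of
the cofactor in the disc around `1`. -/
theorem LogDomain.intCast {a : ℤ} (ha : a ≠ 0) : LogDomain p (a : ℂ_[p]) := by
  obtain ⟨m, hm, h⟩ := (Int.finiteMultiplicity_iff.2
    ⟨(by simpa using (Fact.out : p.Prime).ne_one : (p : ℤ).natAbs ≠ 1), ha⟩).exists_eq_pow_mul_and_not_dvd
  rw [hm]
  push_cast
  refine (LogDomain.prime.pow _).mul ⟨(p - 1, 0), Nat.sub_pos_of_lt (Fact.out : p.Prime).one_lt, ?_⟩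
  have h1 : IsCoprime m p :=
    ((Nat.prime_iff_prime_int.1 (Fact.out : p.Prime)).coprime_iff_not_dvd.2 h).symm
  have h2 : (p : ℤ) ∣ m ^ (p - 1) - 1 :=
    (Int.ModEq.pow_card_sub_one_eq_one (Fact.out : p.Prime) h1).symm.dvd
  have h3 := (Padic.norm_intCast_lt_one_iff (p := p)).2 h2
  rw [← norm_intCast_eq] at h3
  simpa using h3

end Log

/-! ### Reduction from `ℤ^d` to `(ℤ/n)^d` -/

section Reduction

variable {d n : ℕ}

variable (d n) in
/-- Reduction modulo `n` on `ℤ^d`. -/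
def reduce : (Fin d → ℤ) →+ (Fin d → ZMod n) where
  toFun ν i := ν i
  map_zero' := by ext; simp
  map_add' _ _ := by ext; simp

theorem reduce_apply (ν : Fin d → ℤ) (i : Fin d) : reduce d n ν i = (ν i : ZMod n) := rfl

theorem reduce_surjective : Function.Surjective (reduce d n) := fun v =>
  ⟨fun i => (v i).cast, by ext i; simp [reduce_apply]⟩

theorem reduce_eq_zero_iff {ν : Fin d → ℤ} : reduce d n ν = 0 ↔ ν ∈ lattice d n := by
  rw [funext_iff]
  exact forall_congr' fun i => ZMod.intCast_zmod_eq_zero_iff_dvd _ _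

variable (n) in
/-- `L_d(R) → R[(ℤ/n)^d]`. -/
def reduceHom (R : Type*) [CommRing R] : Laurent d R →+* AddMonoidAlgebra R (Fin d → ZMod n) :=
  AddMonoidAlgebra.mapDomainRingHom R (reduce d n)

theorem reduceHom_single {R : Type*} [CommRing R] (ν : Fin d → ℤ) (a : R) :
    reduceHom n R (AddMonoidAlgebra.single ν a) = AddMonoidAlgebra.single (reduce d n ν) a := by
  simp [reduceHom]

theorem reduceHom_surjective {R : Type*} [CommRing R] :
    Function.Surjective (reduceHom (d := d) n R) := fun x => by
  induction x using AddMonoidAlgebra.induction_linear with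
  | zero => exact ⟨0, map_zero _⟩
  | add x y hx hy =>
    obtain ⟨a, rfl⟩ := hx
    obtain ⟨b, rfl⟩ := hy
    exact ⟨a + b, map_add _ _ _⟩
  | single g a =>
    obtain ⟨ν, rfl⟩ := reduce_surjective g
    exact ⟨_, reduceHom_single ν a⟩

theorem reduceHom_map {R S : Type*} [CommRing R] [CommRing S] (φ : R →+* S) (f : Laurent d R) :
    reduceHom n S (Laurent.map d φ f) =
      AddMonoidAlgebra.mapRingHom (Fin d → ZMod n) φ (reduceHom n R f) := by
  induction f using AddMonoidAlgebra.induction_linear with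
  | zero => simp
  | add x y hx hy => simp only [map_add, hx, hy]
  | single ν a => simp only [reduceHom_single, AddMonoidAlgebra.mapRingHom_single]

end Reduction

/-! ### Characters of `(ℤ/n)^d` and the group determinant -/

section RootsOfUnity

variable {F : Type*} [Field F] {d : ℕ}

/-- The monomial character `ν ↦ z^ν` of `ℤ^d` attached to a point with non-zero coordinates. -/
def monomialHom (z : Fin d → F) (hz : ∀ i, z i ≠ 0) : Multiplicative (Fin d → ℤ) →* F where
  toFun ν := ∏ i, z i ^ ν.toAdd i
  map_one' := by simp
  map_mul' ν μ := by simp [zpow_add₀ (hz _), Finset.prod_mul_distrib]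

theorem eval_eq_lift (f : Laurent d F) {z : Fin d → F} (hz : ∀ i, z i ≠ 0) :
    f.eval z = AddMonoidAlgebra.lift F F (Fin d → ℤ) (monomialHom z hz) f := by
  rw [AddMonoidAlgebra.lift_apply]
  rfl

theorem eval_mul (f g : Laurent d F) {z : Fin d → F} (hz : ∀ i, z i ≠ 0) :
    (f * g).eval z = f.eval z * g.eval z := by
  simp only [eval_eq_lift _ hz, map_mul]

theorem eval_add (f g : Laurent d F) {z : Fin d → F} (hz : ∀ i, z i ≠ 0) :
    (f + g).eval z = f.eval z + g.eval z := by
  simp only [eval_eq_lift _ hz, map_add]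

theorem eval_pow (f : Laurent d F) {z : Fin d → F} (hz : ∀ i, z i ≠ 0) (k : ℕ) :
    (f ^ k).eval z = f.eval z ^ k := by
  simp only [eval_eq_lift _ hz, map_pow]

theorem eval_one {z : Fin d → F} (hz : ∀ i, z i ≠ 0) : (1 : Laurent d F).eval z = 1 := by
  simp only [eval_eq_lift _ hz, map_one]

theorem eval_prod {ι : Type*} (s : Finset ι) (f : ι → Laurent d F) {z : Fin d → F}
    (hz : ∀ i, z i ≠ 0) : (∏ j ∈ s, f j).eval z = ∏ j ∈ s, (f j).eval z := by
  simp only [eval_eq_lift _ hz, map_prod]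

theorem eval_single (ν : Fin d → ℤ) (a : F) (z : Fin d → F) :
    Laurent.eval (AddMonoidAlgebra.single ν a) z = a * ∏ i, z i ^ ν i := by
  simp [Laurent.eval, Finsupp.sum_single_index]

variable (F d) in
/-- The finite set `μ_n^d` in a field. -/
def rootTuples (n : ℕ) : Finset (Fin d → F) :=
  Fintype.piFinset fun _ => Polynomial.nthRootsFinset n (1 : F)

theorem card_rootTuples {n : ℕ} {ω : F} (hω : IsPrimitiveRoot ω n) :
    (rootTuples F d n).card = n ^ d := by
  simp [rootTuples, hω.card_nthRootsFinset]

variable {n : ℕ} [NeZero n]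

theorem mem_rootTuples {ζ : Fin d → F} : ζ ∈ rootTuples F d n ↔ ∀ i, ζ i ^ n = 1 := by
  simp [rootTuples, Polynomial.mem_nthRootsFinset (NeZero.pos n)]

theorem ne_zero_of_mem_rootTuples {ζ : Fin d → F} (h : ζ ∈ rootTuples F d n) (i : Fin d) :
    ζ i ≠ 0 := fun h0 => by
  have := mem_rootTuples.1 h i
  simp [h0, NeZero.ne n] at this

theorem zpow_eq_pow_val {z : F} (hz : z ^ n = 1) (k : ℤ) : z ^ k = z ^ (k : ZMod n).val := by
  have h0 : z ≠ 0 := fun h0 => by simp [h0, NeZero.ne n] at hz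
  rw [← zpow_natCast z (ZMod.val _), ZMod.val_intCast]
  rw [← zpow_natCast] at hz
  conv_lhs => rw [← Int.emod_add_mul_ediv k n, zpow_add₀ h0, zpow_mul, hz, one_zpow, mul_one]

/-- The character of `(ℤ/n)^d` attached to a tuple of `n`-th roots of unity. -/
def rootHom (ζ : Fin d → F) (h : ζ ∈ rootTuples F d n) :
    Multiplicative (Fin d → ZMod n) →* F where
  toFun v := ∏ i, ζ i ^ (v.toAdd i).val
  map_one' := by simp
  map_mul' v w := by
    rw [← Finset.prod_mul_distrib]
    refine Finset.prod_congr rfl fun i _ => ?_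
    rw [toAdd_mul, Pi.add_apply, ZMod.val_add, ← pow_add]
    exact (pow_eq_pow_mod _ (mem_rootTuples.1 h i)).symm

theorem eval_eq_lift_reduceHom (f : Laurent d F) {ζ : Fin d → F} (h : ζ ∈ rootTuples F d n) :
    f.eval ζ = AddMonoidAlgebra.lift F F _ (rootHom ζ h) (reduceHom n F f) := by
  rw [eval_eq_lift f (ne_zero_of_mem_rootTuples h)]
  induction f using AddMonoidAlgebra.induction_linear with
  | zero => simp
  | add x y hx hy => simp only [map_add, hx, hy]
  | single ν a =>
    rw [reduceHom_single, AddMonoidAlgebra.lift_single, AddMonoidAlgebra.lift_single]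
    congr 1
    change ∏ i, ζ i ^ ν i = ∏ i, ζ i ^ (ν i : ZMod n).val
    exact Finset.prod_congr rfl fun i _ => zpow_eq_pow_val (mem_rootTuples.1 h i) (ν i)

variable {ω : F}

theorem sum_nthRoots_pow (hω : IsPrimitiveRoot ω n) (a : ZMod n) :
    ∑ ζ ∈ Polynomial.nthRootsFinset n (1 : F), ζ ^ a.val = if a = 0 then (n : F) else 0 := by
  have hn := NeZero.pos n
  split_ifs with ha
  · simp [ha, hω.card_nthRootsFinset]
  · have h0 : ω ≠ 0 := hω.ne_zero hn.ne'
    have h1 : ω ^ a.val ≠ 1 := hω.pow_ne_one_of_pos_of_lt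
      (by simpa using ha) (ZMod.val_lt a)
    -- Multiplication by `ω` permutes the `n`-th roots of unity, so the sum is fixed by the factor
    -- `ω^a ≠ 1` and must vanish.
    have h2 : ω ^ a.val * ∑ ζ ∈ Polynomial.nthRootsFinset n (1 : F), ζ ^ a.val =
        ∑ ζ ∈ Polynomial.nthRootsFinset n (1 : F), ζ ^ a.val := by
      rw [Finset.mul_sum]
      refine Finset.sum_nbij' (ω * ·) (ω⁻¹ * ·) ?_ ?_ ?_ ?_ ?_
      · intro ζ hζ
        rw [Polynomial.mem_nthRootsFinset hn] at hζ ⊢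
        rw [mul_pow, hζ, hω.pow_eq_one, one_mul]
      · intro ζ hζ
        rw [Polynomial.mem_nthRootsFinset hn] at hζ ⊢
        rw [mul_pow, hζ, inv_pow, hω.pow_eq_one, inv_one, one_mul]
      · exact fun ζ _ => inv_mul_cancel_left₀ h0 ζ
      · exact fun ζ _ => mul_inv_cancel_left₀ h0 ζ
      · exact fun ζ _ => (mul_pow _ _ _).symm
    exact (mul_left_eq_self₀.1 h2).resolve_left h1

theorem sum_rootHom (hω : IsPrimitiveRoot ω n) (v : Fin d → ZMod n) :
    ∑ ζ ∈ (rootTuples F d n).attach, rootHom ζ.1 ζ.2 (.ofAdd v) =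
      if v = 0 then (n : F) ^ d else 0 := by
  change ∑ ζ ∈ (rootTuples F d n).attach, ∏ i, ζ.1 i ^ (v i).val = _
  rw [Finset.sum_attach (rootTuples F d n) fun ζ => ∏ i, ζ i ^ (v i).val, rootTuples,
    ← Finset.prod_univ_sum (fun _ => Polynomial.nthRootsFinset n (1 : F))
      fun i z => z ^ (v i).val]
  simp only [sum_nthRoots_pow hω]
  split_ifs with hv
  · simp [hv]
  · obtain ⟨i, hi⟩ := Function.ne_iff.1 hv
    exact Finset.prod_eq_zero (Finset.mem_univ i) (if_neg hi)

theorem sum_lift_rootHom (hω : IsPrimitiveRoot ω n) (y : AddMonoidAlgebra F (Fin d → ZMod n)) :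
    ∑ ζ ∈ (rootTuples F d n).attach, AddMonoidAlgebra.lift F F _ (rootHom ζ.1 ζ.2) y =
      (n : F) ^ d * y.coeff 0 := by
  induction y using AddMonoidAlgebra.induction_linear with
  | zero => simp
  | add x y hx hy =>
    simp only [map_add, Finset.sum_add_distrib, hx, hy, AddMonoidAlgebra.coeff_add,
      Finsupp.add_apply, mul_add]
  | single g a =>
    simp only [AddMonoidAlgebra.lift_single, smul_eq_mul, ← Finset.mul_sum, sum_rootHom hω,
      AddMonoidAlgebra.coeff_single, Finsupp.single_apply]
    split_ifs <;> ring

/-- Averages over `μ_n^d` extract the coefficients at the multiples of `n`. -/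
theorem sum_eval_rootTuples (hω : IsPrimitiveRoot ω n) (f : Laurent d F) :
    ∑ ζ ∈ rootTuples F d n, f.eval ζ = (n : F) ^ d * (reduceHom n F f).coeff 0 := by
  rw [← sum_lift_rootHom hω, ← Finset.sum_attach]
  exact Finset.sum_congr rfl fun ζ _ => eval_eq_lift_reduceHom f ζ.2

theorem norm_pi {ι : Type*} [Fintype ι] (v : ι → F) : Algebra.norm F v = ∏ i, v i := by
  classical
  rw [Algebra.norm_eq_matrix_det (Pi.basisFun F ι), ← Matrix.det_diagonal]
  congr 1
  ext i j
  rw [Algebra.leftMulMatrix_eq_repr_mul]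
  simp [Matrix.diagonal_apply, Pi.single_apply]

/-- The norm of an element of the group algebra of `(ℤ/n)^d` is the product of its values at all
characters. -/
theorem norm_groupAlgebra (hω : IsPrimitiveRoot ω n) (hn : (n : F) ≠ 0) (y : AddMonoidAlgebra F (Fin d → ZMod n)) :
    Algebra.norm F y =
      ∏ ζ ∈ (rootTuples F d n).attach, AddMonoidAlgebra.lift F F _ (rootHom ζ.1 ζ.2) y := by
  let Φ : AddMonoidAlgebra F (Fin d → ZMod n) →ₐ[F] (rootTuples F d n → F) :=
    AlgHom.pi fun ζ => AddMonoidAlgebra.lift F F _ (rootHom ζ.1 ζ.2)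
  -- Fourier inversion: translating by `-g` moves the coefficient at `g` to `0`, where the sum over
  -- all characters recovers it up to the factor `n^d ≠ 0`.
  have hinj : Function.Injective Φ := by
    rw [injective_iff_map_eq_zero]
    intro x hx
    ext g
    have h1 := sum_lift_rootHom hω (x * AddMonoidAlgebra.single (-g) 1)
    have h2 : (x * AddMonoidAlgebra.single (-g) (1 : F)).coeff 0 = x.coeff g := by
      have := AddMonoidAlgebra.coeff_mul_single_eq_coeff_mul (x := x) (r := (1 : F)) (m := -g)
        (m₁ := 0) g (fun m' _ => by rw [← sub_eq_add_neg, sub_eq_zero])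
      simpa only [mul_one] using this
    rw [h2] at h1
    have h3 : ∀ ζ : rootTuples F d n,
        AddMonoidAlgebra.lift F F _ (rootHom ζ.1 ζ.2) x = 0 := fun ζ => congrFun hx ζ
    simp only [map_mul, h3, zero_mul, Finset.sum_const_zero] at h1
    simpa [hn] using h1.symm
  have hfin : Module.finrank F (AddMonoidAlgebra F (Fin d → ZMod n)) =
      Module.finrank F (rootTuples F d n → F) := by
    rw [Module.finrank_eq_card_basis (AddMonoidAlgebra.basis _ F), Module.finrank_fintype_fun_eq_card]
    simp [card_rootTuples hω]
  have : Module.Finite F (AddMonoidAlgebra F (Fin d → ZMod n)) :=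
    .of_basis (AddMonoidAlgebra.basis _ F)
  have hbij : Function.Bijective Φ :=
    ⟨hinj, (LinearMap.injective_iff_surjective_of_finrank_eq_finrank (f := Φ.toLinearMap) hfin).1
      hinj⟩
  rw [← Algebra.norm_eq_of_algEquiv (AlgEquiv.ofBijective Φ hbij), norm_pi]
  rfl

theorem norm_reduceHom (hω : IsPrimitiveRoot ω n) (hn : (n : F) ≠ 0) (f : Laurent d F) :
    Algebra.norm F (reduceHom n F f) = ∏ ζ ∈ rootTuples F d n, f.eval ζ := by
  rw [norm_groupAlgebra hω hn, ← Finset.prod_attach (rootTuples F d n)]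
  exact Finset.prod_congr rfl fun ζ _ => (eval_eq_lift_reduceHom f ζ.2).symm

end RootsOfUnity

/-- The norm of a group algebra commutes with base change. -/
theorem norm_mapRingHom {R S G : Type*} [CommRing R] [CommRing S] [AddCommGroup G] [Finite G]
    (φ : R →+* S) (y : AddMonoidAlgebra R G) :
    Algebra.norm S (AddMonoidAlgebra.mapRingHom G φ y) = φ (Algebra.norm R y) := by
  classical
  have := Fintype.ofFinite G
  rw [Algebra.norm_eq_matrix_det (AddMonoidAlgebra.basis G S),
    Algebra.norm_eq_matrix_det (AddMonoidAlgebra.basis G R), RingHom.map_det]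
  congr 1
  ext i j
  rw [RingHom.mapMatrix_apply, Matrix.map_apply, Algebra.leftMulMatrix_eq_repr_mul,
    Algebra.leftMulMatrix_eq_repr_mul]
  have h (x : AddMonoidAlgebra R G) : (AddMonoidAlgebra.basis G R).repr x i = x.coeff i := rfl
  have h' (x : AddMonoidAlgebra S G) : (AddMonoidAlgebra.basis G S).repr x i = x.coeff i := rfl
  rw [h, h', AddMonoidAlgebra.basis_apply, AddMonoidAlgebra.basis_apply,
    ← AddMonoidAlgebra.coeff_mapRingHom, map_mul, AddMonoidAlgebra.mapRingHom_single, map_one]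

/-! ### Dominant coefficients from the absence of zeros on the torus -/

section Dominant

variable {p : ℕ} [Fact p.Prime] {d : ℕ}

/-- A polynomial over `ℂ_p` without roots of norm `1` has a single dominant coefficient. -/
theorem exists_dominant_coeff {P : Polynomial ℂ_[p]} (hP : P ≠ 0)
    (hroot : ∀ s : ℂ_[p], ‖s‖ = 1 → P.eval s ≠ 0) :
    ∃ m, ∀ i, i ≠ m → ‖P.coeff i‖ < ‖P.coeff m‖ := by
  induction hn : P.natDegree generalizing P with
  | zero =>
    rw [Polynomial.eq_C_of_natDegree_eq_zero hn] at hP ⊢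
    refine ⟨0, fun i hi => ?_⟩
    rw [Polynomial.coeff_C_zero, Polynomial.coeff_C_of_ne_zero hi, norm_zero, norm_pos_iff]
    exact fun h => hP (by rw [h, Polynomial.C_0])
  | succ n ih =>
    -- Induction on the degree: split off a linear factor `X - α` with `|α| ≠ 1` and follow the
    -- dominant index of the cofactor `Q`.
    obtain ⟨α, hα⟩ := IsAlgClosed.exists_root P fun h => by
      rw [Polynomial.degree_eq_natDegree hP, hn] at h
      exact absurd h (by exact_mod_cast n.succ_ne_zero)
    obtain ⟨Q, rfl⟩ := Polynomial.dvd_iff_isRoot.2 hα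
    have hQ : Q ≠ 0 := right_ne_zero_of_mul hP
    obtain ⟨m, hm⟩ := ih hQ (fun s hs h => hroot s hs (by rw [Polynomial.eval_mul, h, mul_zero]))
      (by rw [Polynomial.natDegree_mul (Polynomial.X_sub_C_ne_zero α) hQ,
            Polynomial.natDegree_X_sub_C] at hn; omega)
    have hα1 : ‖α‖ ≠ 1 := fun h => hroot α h hα
    have hpos : 0 < ‖Q.coeff m‖ := (norm_nonneg _).trans_lt (hm (m + 1) (by omega))
    have hle : ∀ i, ‖Q.coeff i‖ ≤ ‖Q.coeff m‖ := fun i => by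
      by_cases h : i = m
      · rw [h]
      · exact (hm i h).le
    have c0 : ((Polynomial.X - Polynomial.C α) * Q).coeff 0 = 0 - α * Q.coeff 0 := by simp
    have cs : ∀ i, ((Polynomial.X - Polynomial.C α) * Q).coeff (i + 1) =
        Q.coeff i - α * Q.coeff (i + 1) := fun i => by
      rw [sub_mul, Polynomial.coeff_sub, Polynomial.coeff_X_mul, Polynomial.coeff_C_mul]
    have hsub : ∀ {x y : ℂ_[p]} {c : ℝ}, ‖x‖ < c → ‖y‖ < c → ‖x - y‖ < c := fun hx hy =>
      by
      rw [sub_eq_add_neg]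
      exact (IsUltrametricDist.norm_add_le_max _ _).trans_lt (max_lt hx (by rwa [norm_neg]))
    have hsubl : ∀ {x y : ℂ_[p]}, ‖y‖ < ‖x‖ → ‖x - y‖ = ‖x‖ := fun {x y} h => by
      rw [sub_eq_add_neg, IsUltrametricDist.norm_add_eq_max_of_norm_ne_norm
        (by rw [norm_neg]; exact h.ne'), norm_neg, max_eq_left h.le]
    have hsubr : ∀ {x y : ℂ_[p]}, ‖x‖ < ‖y‖ → ‖x - y‖ = ‖y‖ := fun h => by
      rw [norm_sub_rev, hsubl h]
    rcases hα1.lt_or_gt with h | h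
    -- For `|α| < 1` the summand `XQ` wins, so the dominant index moves up by one.
    · have hlt : ∀ i, ‖α * Q.coeff i‖ < ‖Q.coeff m‖ := fun i => by
        rw [norm_mul]
        exact (mul_le_mul_of_nonneg_left (hle i) (norm_nonneg _)).trans_lt
          (mul_lt_of_lt_one_left hpos h)
      refine ⟨m + 1, fun i hi => ?_⟩
      rw [cs m, hsubl (hlt _)]
      cases i with
      | zero =>
        rw [c0]
        exact hsub (by rwa [norm_zero]) (hlt 0)
      | succ i =>
        rw [cs]
        exact hsub (hm i (by omega)) (hlt _)
    -- For `|α| > 1` the summand `-αQ` wins, so the dominant index stays.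
    · have hbig : ∀ i, ‖Q.coeff i‖ < ‖α * Q.coeff m‖ := fun i => by
        rw [norm_mul]
        exact (hle i).trans_lt (lt_mul_of_one_lt_left hpos h)
      have hlt : ∀ i, i ≠ m → ‖α * Q.coeff i‖ < ‖α * Q.coeff m‖ := fun i hi => by
        rw [norm_mul, norm_mul]
        exact mul_lt_mul_of_pos_left (hm i hi) (one_pos.trans h)
      have hmm : ‖((Polynomial.X - Polynomial.C α) * Q).coeff m‖ = ‖α * Q.coeff m‖ := by
        cases m with
        | zero => rw [c0, zero_sub, norm_neg]
        | succ m => rw [cs, hsubr (hbig m)]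
      refine ⟨m, fun i hi => ?_⟩
      rw [hmm]
      cases i with
      | zero =>
        rw [c0, zero_sub, norm_neg]
        exact hlt 0 hi
      | succ i =>
        rw [cs]
        exact hsub (hbig i) (hlt _ hi)

/-- Some linear form `∑ νᵢ Bⁱ` separates the points of a finite set of integer vectors. -/
theorem exists_separating_base (S : Finset (Fin d → ℤ)) :
    ∃ B : ℤ, Set.InjOn (fun ν : Fin d → ℤ => ∑ i, ν i * B ^ (i : ℕ)) S := by
  classical
  -- The linear form is the value at `B` of a polynomial with coefficients `νᵢ`. Take `B` to be a
  -- non-root of the product of these polynomials over all differences of distinct points.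
  let D : (Fin d → ℤ) → Polynomial ℤ := fun ν =>
    ∑ i : Fin d, Polynomial.monomial (i : ℕ) (ν i)
  have hD : ∀ ν, ν ≠ 0 → D ν ≠ 0 := by
    intro ν hν h
    obtain ⟨j, hj⟩ := Function.ne_iff.1 hν
    refine hj ?_
    have := congrArg (fun P => Polynomial.coeff P (j : ℕ)) h
    simpa [D, Polynomial.finsetSum_coeff, Polynomial.coeff_monomial, Fin.val_inj] using this
  have hprod : ∏ x ∈ S.offDiag, D (x.1 - x.2) ≠ 0 :=
    Finset.prod_ne_zero_iff.2 fun x hx => hD _ (sub_ne_zero.2 (Finset.mem_offDiag.1 hx).2.2)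
  obtain ⟨B, hB⟩ : ∃ B : ℤ, (∏ x ∈ S.offDiag, D (x.1 - x.2)).eval B ≠ 0 := by
    by_contra! h
    exact hprod (Polynomial.funext fun B => by rw [h B, Polynomial.eval_zero])
  refine ⟨B, fun ν hν μ hμ h => ?_⟩
  by_contra hne
  rw [Polynomial.eval_prod] at hB
  refine Finset.prod_ne_zero_iff.1 hB (ν, μ)
    (Finset.mem_offDiag.2 ⟨hν, hμ, hne⟩) ?_
  simpa [D, Polynomial.eval_finsetSum, sub_mul, sub_eq_zero] using h

theorem zpow_sum {F ι : Type*} [Field F] {s : F} (hs : s ≠ 0) (t : Finset ι) (e : ι → ℤ) :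
    s ^ (∑ i ∈ t, e i) = ∏ i ∈ t, s ^ e i := by
  classical
  induction t using Finset.induction_on with
  | empty => simp
  | insert i t hi ih => rw [Finset.sum_insert hi, Finset.prod_insert hi, zpow_add₀ hs, ih]

/-- A Laurent polynomial over `ℂ_p` without zeros on the `p`-adic torus has a single dominant
coefficient. -/
theorem exists_dominant_monomial {f : Laurent d ℂ_[p]} (hf : ∀ z ∈ torus p d, f.eval z ≠ 0) :
    ∃ ν₀, f.coeff ν₀ ≠ 0 ∧ ∀ ν, ν ≠ ν₀ → ‖f.coeff ν‖ < ‖f.coeff ν₀‖ := by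
  classical
  -- Reduce to one variable along the curve `zᵢ = s^(Bⁱ)`, which lies on the torus when `|s| = 1`.
  -- As `B` separates the support, no coefficients merge; the shift by `M` clears negative
  -- exponents.
  obtain ⟨B, hB⟩ := exists_separating_base f.coeff.support
  let l : (Fin d → ℤ) → ℤ := fun ν => ∑ i, ν i * B ^ (i : ℕ)
  obtain ⟨M, hM⟩ : ∃ M : ℤ, ∀ ν ∈ f.coeff.support, 0 ≤ l ν + M := by
    refine ⟨∑ ν ∈ f.coeff.support, |l ν|, fun ν hν => ?_⟩
    have := Finset.single_le_sum (f := fun ν => |l ν|) (fun _ _ => abs_nonneg _) hν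
    have := neg_abs_le (l ν)
    linarith
  let e : (Fin d → ℤ) → ℕ := fun ν => (l ν + M).toNat
  have he : Set.InjOn e f.coeff.support := fun ν hν μ hμ h => hB hν hμ <| by
    have h1 := Int.toNat_of_nonneg (hM ν hν)
    have h2 := Int.toNat_of_nonneg (hM μ hμ)
    have h3 : (l ν + M).toNat = (l μ + M).toNat := h
    change l ν = l μ
    omega
  let P : Polynomial ℂ_[p] := ∑ ν ∈ f.coeff.support, Polynomial.monomial (e ν) (f.coeff ν)
  have hPc : ∀ k, P.coeff k = ∑ ν ∈ f.coeff.support, if e ν = k then f.coeff ν else 0 := fun k => by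
    simp only [P, Polynomial.finsetSum_coeff, Polynomial.coeff_monomial]
  have hPe : ∀ ν ∈ f.coeff.support, P.coeff (e ν) = f.coeff ν := fun ν hν => by
    rw [hPc, Finset.sum_eq_single ν (fun μ hμ hne => if_neg fun h => hne (he hμ hν h))
      (fun h => absurd hν h), if_pos rfl]
  have hne : f.coeff.support.Nonempty := by
    rw [Finset.nonempty_iff_ne_empty]
    intro h
    refine hf (fun _ => 1) (fun i => norm_one) ?_
    rw [Laurent.eval, Finsupp.sum, h, Finset.sum_empty]
  obtain ⟨μ, hμ⟩ := hne
  have hP : P ≠ 0 := fun h => by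
    have := hPe μ hμ
    rw [h, Polynomial.coeff_zero] at this
    exact Finsupp.mem_support_iff.1 hμ this.symm
  obtain ⟨m, hm⟩ := exists_dominant_coeff hP fun s hs h => by
    have hs0 : s ≠ 0 := norm_ne_zero_iff.1 (by rw [hs]; exact one_ne_zero)
    refine hf (fun i => s ^ (B ^ (i : ℕ))) (fun i => by rw [norm_zpow, hs, one_zpow]) ?_
    have h1 : s ^ M * f.eval (fun i => s ^ (B ^ (i : ℕ))) = P.eval s := by
      simp only [P, Laurent.eval, Finsupp.sum, Finset.mul_sum, Polynomial.eval_finsetSum,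
        Polynomial.eval_monomial]
      refine Finset.sum_congr rfl fun ν hν => ?_
      have h2 : ∏ i : Fin d, (s ^ (B ^ (i : ℕ))) ^ ν i = s ^ l ν := by
        rw [zpow_sum hs0]
        exact Finset.prod_congr rfl fun i _ => by rw [← zpow_mul, mul_comm]
      rw [h2, ← zpow_natCast s (e ν), Int.toNat_of_nonneg (hM ν hν), zpow_add₀ hs0]
      ring
    exact (mul_eq_zero.1 (h1.trans h)).resolve_left (zpow_ne_zero _ hs0)
  have hPm : P.coeff m ≠ 0 := norm_pos_iff.1 ((norm_nonneg _).trans_lt (hm (m + 1) (by omega)))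
  obtain ⟨ν₀, hν₀, hm₀⟩ : ∃ ν₀ ∈ f.coeff.support, e ν₀ = m := by
    by_contra! h
    exact hPm (by rw [hPc, Finset.sum_eq_zero fun ν hν => if_neg (h ν hν)])
  rw [← hm₀, hPe ν₀ hν₀] at hm
  have h0 := Finsupp.mem_support_iff.1 hν₀
  refine ⟨ν₀, h0, fun ν hν => ?_⟩
  by_cases hs : ν ∈ f.coeff.support
  · rw [← hPe ν hs]
    exact hm _ fun h => hν (he hs hν₀ h)
  · rw [Finsupp.notMem_support_iff.1 hs, norm_zero]
    exact norm_pos_iff.2 h0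

theorem norm_eval_le {g : Laurent d ℂ_[p]} {r : ℝ} (hr : 0 ≤ r) (hg : ∀ ν, ‖g.coeff ν‖ ≤ r)
    {z : Fin d → ℂ_[p]} (hz : z ∈ torus p d) : ‖g.eval z‖ ≤ r := by
  refine IsUltrametricDist.norm_sum_le_of_forall_le_of_nonneg hr fun ν _ => ?_
  rw [norm_mul, norm_prod, Finset.prod_eq_one fun i _ => by rw [norm_zpow, hz i, one_zpow], mul_one]
  exact hg ν

/-- A Laurent polynomial without zeros on the torus is a monomial times `1 + g` with `g` small. -/
theorem exists_eq_single_mul {f : Laurent d ℂ_[p]} (hf : ∀ z ∈ torus p d, f.eval z ≠ 0) :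
    ∃ (ν₀ : Fin d → ℤ) (g : Laurent d ℂ_[p]) (r : ℝ), f.coeff ν₀ ≠ 0 ∧
      f = AddMonoidAlgebra.single ν₀ (f.coeff ν₀) * (1 + g) ∧ 0 ≤ r ∧ r < 1 ∧
      ∀ z ∈ torus p d, ‖g.eval z‖ ≤ r := by
  classical
  obtain ⟨ν₀, h0, hlt⟩ := exists_dominant_monomial hf
  let g : Laurent d ℂ_[p] := AddMonoidAlgebra.single (-ν₀) (f.coeff ν₀)⁻¹ * f - 1
  have hg : ∀ ν, g.coeff ν =
      (f.coeff ν₀)⁻¹ * f.coeff (ν + ν₀) - if ν = 0 then 1 else 0 := fun ν => by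
    have := AddMonoidAlgebra.coeff_single_mul_eq_mul_coeff (x := f) (r := (f.coeff ν₀)⁻¹)
      (m := -ν₀) (m₁ := ν) (ν + ν₀)
      (fun μ _ => by rw [neg_add_eq_iff_eq_add, add_comm])
    rw [← this, AddMonoidAlgebra.coeff_sub, Finsupp.sub_apply, AddMonoidAlgebra.one_def,
      AddMonoidAlgebra.coeff_single, Finsupp.single_apply]
    simp only [eq_comm]
  have hg1 : ∀ ν, ‖g.coeff ν‖ < 1 := fun ν => by
    rw [hg]
    split_ifs with h
    · simp [h, h0]
    · rw [sub_zero, norm_mul, norm_inv, inv_mul_lt_one₀ (norm_pos_iff.2 h0)]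
      exact hlt _ fun h' => h (by simpa using h')
  -- A maximum of finitely many norms below `1`; for `g = 0` the empty supremum in `NNReal` is `0`.
  refine ⟨ν₀, g, (g.coeff.support.sup fun ν => ‖g.coeff ν‖₊ : NNReal), h0, ?_, NNReal.coe_nonneg _,
    ?_, fun z hz => norm_eval_le (NNReal.coe_nonneg _) (fun ν => ?_) hz⟩
  · simp only [g, add_sub_cancel, ← mul_assoc, AddMonoidAlgebra.single_mul_single, add_neg_cancel,
      mul_inv_cancel₀ h0]
    rw [← AddMonoidAlgebra.one_def, one_mul]
  · have : (g.coeff.support.sup fun ν => ‖g.coeff ν‖₊ : NNReal) < 1 :=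
      (Finset.sup_lt_iff one_pos).2 fun ν _ => hg1 ν
    exact_mod_cast this
  · by_cases hs : ν ∈ g.coeff.support
    · exact_mod_cast Finset.le_sup (f := fun ν => ‖g.coeff ν‖₊) hs
    · rw [Finsupp.notMem_support_iff.1 hs, norm_zero]
      exact NNReal.coe_nonneg _

end Dominant

/-! ### Convergence of the Mahler averages -/

section Mahler

variable {d : ℕ}

/-- The support is finite, so for large `n` no nonzero exponent in it is divisible by `n` in every
coordinate. -/
theorem eventually_coeff_zero_reduceHom {R : Type*} [CommRing R] (f : Laurent d R) :
    ∀ᶠ n in atTop, (reduceHom n R f).coeff 0 = f.coeff 0 := by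
  induction f using AddMonoidAlgebra.induction_linear with
  | zero => simp
  | add x y hx hy =>
    filter_upwards [hx, hy] with n h1 h2
    rw [map_add, AddMonoidAlgebra.coeff_add, AddMonoidAlgebra.coeff_add, Finsupp.add_apply,
      Finsupp.add_apply, h1, h2]
  | single ν a =>
    have h : ∀ᶠ n : ℕ in atTop, ∀ i, |ν i| < (n : ℤ) := eventually_all.2 fun i => by
      filter_upwards [eventually_gt_atTop (ν i).natAbs] with n hn
      rw [Int.abs_eq_natAbs]
      exact_mod_cast hn
    filter_upwards [h] with n hn
    classical
    have h1 : reduce d n ν = 0 ↔ ν = 0 := ⟨fun h => funext fun i =>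
      Int.eq_zero_of_abs_lt_dvd (reduce_eq_zero_iff.1 h i) (hn i), fun h => by rw [h, map_zero]⟩
    simp only [reduceHom_single, AddMonoidAlgebra.coeff_single, Finsupp.single_apply, h1]

variable {p : ℕ} [Fact p.Prime]

theorem mem_torus_of_mem_rootsTorus {N : ℕ} [NeZero N] {ζ : Fin d → ℂ_[p]}
    (h : ζ ∈ rootsTorus p d N) : ζ ∈ torus p d := fun i =>
  (pow_eq_one_iff_of_nonneg (norm_nonneg _) (NeZero.ne N)).1
    (by rw [← norm_pow, mem_rootTuples.1 h i, norm_one])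

/-- Since `gcd(0, p) = p ≠ 1`, coprimality already excludes the degenerate index `0`. -/
theorem neZero_of_coprime {N : ℕ} (h : N.Coprime p) : NeZero N :=
  ⟨fun h0 => (Fact.out : p.Prime).ne_one (by simpa [h0] using h)⟩

theorem exists_isPrimitiveRoot {F : Type*} [Field F] [IsAlgClosed F] [CharZero F] (N : ℕ)
    [NeZero N] : ∃ ω : F, IsPrimitiveRoot ω N :=
  HasEnoughRootsOfUnity.exists_primitiveRoot F N

theorem norm_natCast_eq_one {N : ℕ} (h : N.Coprime p) : ‖(N : ℂ_[p])‖ = 1 := by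
  rw [norm_natCast_eq]
  exact Padic.norm_natCast_eq_one_iff.2 h.symm

theorem log_eval_of_eq_single_mul {f g : Laurent d ℂ_[p]} {ν₀ : Fin d → ℤ} {a : ℂ_[p]}
    (ha : LogDomain p a) (hfg : f = AddMonoidAlgebra.single ν₀ a * (1 + g))
    {N : ℕ} [NeZero N] {ζ : Fin d → ℂ_[p]} (hζ : ζ ∈ rootsTorus p d N) (hg : ‖g.eval ζ‖ < 1) :
    LogDomain p (f.eval ζ) ∧ log p (f.eval ζ) = log p a + logSeries p (1 + g.eval ζ) := by
  have hz : ∀ i, ζ i ≠ 0 := ne_zero_of_mem_rootTuples hζ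
  have h1 : (∏ i, ζ i ^ ν₀ i) ^ N = 1 := by
    rw [← Finset.prod_pow]
    refine Finset.prod_eq_one fun i _ => ?_
    rw [← zpow_natCast, zpow_comm, zpow_natCast, mem_rootTuples.1 hζ i, one_zpow]
  have hu : ‖1 + g.eval ζ - 1‖ < 1 := by rwa [add_sub_cancel_left]
  have d1 := LogDomain.of_pow_eq_one (NeZero.pos N) h1
  have d2 := LogDomain.of_norm_sub_one_lt hu
  rw [hfg, eval_mul _ _ hz, eval_add _ _ hz, eval_one hz, eval_single]
  refine ⟨(ha.mul d1).mul d2, ?_⟩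
  rw [log_mul (ha.mul d1) d2, log_mul ha d1, log_of_pow_eq_one (NeZero.pos N) h1, add_zero,
    log_eq_logSeries hu]

theorem logSeries_one_add (x : ℂ_[p]) :
    logSeries p (1 + x) = ∑' k : ℕ, (-1) ^ k * x ^ (k + 1) / ((k : ℂ_[p]) + 1) := by
  simp only [logSeries, add_sub_cancel_left]

theorem summable_logSeries {x : ℂ_[p]} (hx : ‖x‖ < 1) :
    Summable fun k : ℕ => (-1) ^ k * x ^ (k + 1) / ((k : ℂ_[p]) + 1) :=
  .of_norm_bounded (summable_logBound (norm_nonneg _) hx)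
    fun k => norm_logTerm_le le_rfl k (by simp)

/-- The averages of `log (1 + g)` over `μ_N^d` converge when `g` is small on the torus. -/
theorem exists_tendsto_average_logSeries {g : Laurent d ℂ_[p]} {r : ℝ} (h0 : 0 ≤ r) (h1 : r < 1)
    (hg : ∀ z ∈ torus p d, ‖g.eval z‖ ≤ r) :
    ∃ m, Tendsto (fun N : ℕ => ((N : ℂ_[p]) ^ d)⁻¹ *
      ∑ ζ ∈ rootsTorus p d N, logSeries p (1 + g.eval ζ)) (primeToAtTop p) (𝓝 m) := by
  have hco : ∀ᶠ N in primeToAtTop p, N.Coprime p :=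
    mem_inf_of_right (mem_principal_self _)
  let T : ℕ → ℕ → ℂ_[p] := fun N k => ((N : ℂ_[p]) ^ d)⁻¹ *
    ∑ ζ ∈ rootsTorus p d N, (-1) ^ k * g.eval ζ ^ (k + 1) / ((k : ℂ_[p]) + 1)
  refine ⟨∑' k : ℕ, (-1) ^ k * (g ^ (k + 1)).coeff 0 / ((k : ℂ_[p]) + 1), ?_⟩
  have hlim : Tendsto (fun N => ∑' k, T N k) (primeToAtTop p)
      (𝓝 (∑' k : ℕ, (-1) ^ k * (g ^ (k + 1)).coeff 0 / ((k : ℂ_[p]) + 1))) := by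
    refine tendsto_tsum_of_dominated_convergence (summable_logBound h0 h1) (fun k => ?_) ?_
    · refine tendsto_const_nhds.congr' ?_
      filter_upwards [hco,
        (eventually_coeff_zero_reduceHom (g ^ (k + 1))).filter_mono inf_le_left] with N hN hk
      have := neZero_of_coprime hN
      obtain ⟨ω, hω⟩ := exists_isPrimitiveRoot (F := ℂ_[p]) N
      have hN0 : (N : ℂ_[p]) ^ d ≠ 0 := pow_ne_zero _ (Nat.cast_ne_zero.2 (NeZero.ne N))
      have hs := sum_eval_rootTuples hω (g ^ (k + 1))
      rw [hk] at hs
      have hs' : ∑ ζ ∈ rootsTorus p d N, g.eval ζ ^ (k + 1) =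
          (N : ℂ_[p]) ^ d * (g ^ (k + 1)).coeff 0 := by
        rw [← hs]
        exact Finset.sum_congr rfl fun ζ hζ =>
          (eval_pow g (ne_zero_of_mem_rootTuples hζ) (k + 1)).symm
      simp only [T]
      rw [← Finset.sum_div, ← Finset.mul_sum, hs']
      field_simp
    · filter_upwards [hco] with N hN k
      have := neZero_of_coprime hN
      -- Coprimality to `p` enters here: `|N^{-d}|_p = 1`, so by the ultrametric inequality the
      -- average obeys the same bound as each term, uniformly in `N`.
      rw [norm_mul, norm_inv, norm_pow, norm_natCast_eq_one hN, one_pow, inv_one, one_mul]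
      exact IsUltrametricDist.norm_sum_le_of_forall_le_of_nonneg (by positivity) fun ζ hζ =>
        norm_logTerm_le (hg ζ (mem_torus_of_mem_rootsTorus hζ)) k (by simp)
  refine hlim.congr' ?_
  filter_upwards [hco] with N hN
  have := neZero_of_coprime hN
  simp only [T, logSeries_one_add]
  rw [tsum_mul_left, Summable.tsum_finsetSum fun ζ hζ => summable_logSeries
    ((hg ζ (mem_torus_of_mem_rootsTorus hζ)).trans_lt h1)]

/-- Existence of the `p`-adic Mahler measure of an integral Laurent polynomial without zeros on
the `p`-adic torus. -/
theorem exists_hasMahlerMeasure {f : Laurent d ℤ}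
    (hf : ∀ z ∈ torus p d, (Laurent.map d (Int.castRingHom ℂ_[p]) f).eval z ≠ 0) :
    ∃ m, HasMahlerMeasure p d (Laurent.map d (Int.castRingHom ℂ_[p]) f) m ∧
      ∀ N : ℕ, N.Coprime p → ∀ ζ ∈ rootsTorus p d N,
        LogDomain p ((Laurent.map d (Int.castRingHom ℂ_[p]) f).eval ζ) := by
  obtain ⟨ν₀, g, r, ha, hfg, h0, h1, hg⟩ := exists_eq_single_mul hf
  set a := (Laurent.map d (Int.castRingHom ℂ_[p]) f).coeff ν₀ with ha'
  -- Integrality of the coefficients places `a` in `LogDomain`.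
  have haℤ : a = (f.coeff ν₀ : ℤ) := by simp [ha']
  have hadom : LogDomain p a := by
    rw [haℤ] at ha ⊢
    exact .intCast (by exact_mod_cast ha)
  obtain ⟨m, hm⟩ := exists_tendsto_average_logSeries h0 h1 hg
  have hlog : ∀ N : ℕ, [NeZero N] → ∀ ζ ∈ rootsTorus p d N, _ := fun N _ ζ hζ =>
    log_eval_of_eq_single_mul hadom hfg hζ ((hg ζ (mem_torus_of_mem_rootsTorus hζ)).trans_lt h1)
  refine ⟨log p a + m, ⟨fun N hN ζ hζ => ?_, ?_⟩, fun N hN ζ hζ => ?_⟩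
  · have := neZero_of_coprime hN
    exact hf ζ (mem_torus_of_mem_rootsTorus hζ)
  · refine (tendsto_const_nhds.add hm).congr' ?_
    have hco : ∀ᶠ N in primeToAtTop p, N.Coprime p :=
      mem_inf_of_right (mem_principal_self _)
    filter_upwards [hco] with N hN
    have := neZero_of_coprime hN
    obtain ⟨ω, hω⟩ := exists_isPrimitiveRoot (F := ℂ_[p]) N
    have hN0 : (N : ℂ_[p]) ^ d ≠ 0 := pow_ne_zero _ (Nat.cast_ne_zero.2 (NeZero.ne N))
    have hcard : (rootsTorus p d N).card = N ^ d := card_rootTuples hω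
    rw [Finset.sum_congr rfl fun ζ hζ => (hlog N ζ hζ).2, Finset.sum_add_distrib,
      Finset.sum_const, hcard, nsmul_eq_mul, mul_add, Nat.cast_pow, inv_mul_cancel_left₀ hN0]
  · have := neZero_of_coprime hN
    exact (hlog N ζ hζ).1

end Mahler

/-! ### Norms over `ℤ` as products over `μ_n^d` -/

section Norm

variable {d n : ℕ} [NeZero n] {K : Type*} [Field K] [NumberField K]

theorem intCast_norm_eq_prod_embeddings (x : 𝓞 K) :
    ((Algebra.norm ℤ x : ℤ) : ℂ) = ∏ τ : K →+* ℂ, τ (x : K) := by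
  have h1 : ((Algebra.norm ℤ x : ℤ) : ℂ) = algebraMap ℚ ℂ (Algebra.norm ℚ (x : K)) := by
    rw [← Algebra.coe_norm_int]
    simp
  rw [h1, Algebra.norm_eq_prod_embeddings ℚ ℂ (x : K)]
  exact (Fintype.prod_equiv (RingHom.equivRatAlgHom K ℂ) _ _ fun τ => rfl).symm

/-- The field is left general because the same integer is read in `ℂ`, to compare with the
embeddings of `K`, and in `ℂ_p`, to take logarithms. -/
theorem intCast_norm_reduceHom {F : Type*} [Field F] [IsAlgClosed F] [CharZero F]
    (f : Laurent d ℤ) :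
    ((Algebra.norm ℤ (reduceHom n ℤ f) : ℤ) : F) =
      ∏ ζ ∈ rootTuples F d n, (Laurent.map d (Int.castRingHom F) f).eval ζ := by
  obtain ⟨ω, hω⟩ := exists_isPrimitiveRoot (F := F) n
  rw [← norm_reduceHom hω (Nat.cast_ne_zero.2 (NeZero.ne n)), reduceHom_map, norm_mapRingHom]
  rfl

/-- In `ℂ`, both sides are the double product of `τ(f)(ζ)` over `τ` and `ζ`; on the left this uses
transitivity of the norm through `𝓞 K`. -/
theorem norm_reduceHom_ringOfIntegers (f : Laurent d (𝓞 K)) :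
    Algebra.norm ℤ (reduceHom n (𝓞 K) f) = Algebra.norm ℤ (reduceHom n ℤ (intNorm f)) := by
  refine Int.cast_injective (α := ℂ) ?_
  obtain ⟨ω, hω⟩ := exists_isPrimitiveRoot (F := ℂ) n
  have hn : (n : ℂ) ≠ 0 := Nat.cast_ne_zero.2 (NeZero.ne n)
  rw [intCast_norm_reduceHom, map_intNorm, ← Algebra.norm_norm (S := 𝓞 K),
    intCast_norm_eq_prod_embeddings,
    Finset.prod_congr rfl fun ζ hζ => eval_prod _ _ (ne_zero_of_mem_rootTuples hζ),
    Finset.prod_comm]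
  refine Finset.prod_congr rfl fun τ _ => ?_
  rw [← norm_reduceHom hω hn, reduceHom_map, norm_mapRingHom]
  rfl

end Norm

/-- The order of `A / xA` for a commutative ring `A` that is a lattice. -/
theorem natCard_quotient_span_singleton {A : Type*} [CommRing A] [Module.Free ℤ A]
    [Module.Finite ℤ A] {x : A} (hx : Algebra.norm ℤ x ≠ 0) :
    Nat.card (A ⧸ Ideal.span {x}) = (Algebra.norm ℤ x).natAbs := by
  have hinj : Function.Injective (Algebra.lmul ℤ A x) := by
    rw [← LinearMap.ker_eq_bot]
    by_contra h
    exact hx (LinearMap.det_eq_zero_iff_ker_ne_bot.2 h)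
  let N : Submodule ℤ A := (Ideal.span {x}).restrictScalars ℤ
  have hN : LinearMap.range (Algebra.lmul ℤ A x) = N := by
    ext y
    simp [N, Ideal.mem_span_singleton', mul_comm]
  -- Multiplication by `x` identifies the lattice `A` with `xA`, whose index is therefore the
  -- absolute value of its determinant.
  let e : A ≃ₗ[ℤ] N := (LinearEquiv.ofInjective _ hinj).trans (LinearEquiv.ofEq _ _ hN)
  rw [Algebra.norm_apply]
  exact (Submodule.natAbs_det_equiv N e).symm

/-! ### Periodic points as characters of a finite quotient -/

section FixedPoints

variable {d n : ℕ} {R : Type*} [CommRing R]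

/-- `R[(ℤ/n)^d] / f`, the largest quotient of `L_d(R) / f` on which `(nℤ)^d` acts trivially. -/
abbrev ReducedModule (n : ℕ) (f : Laurent d R) : Type _ :=
  AddMonoidAlgebra R (Fin d → ZMod n) ⧸ Ideal.span {reduceHom n R f}

/-- The projection `L_d(R) / f → R[(ℤ/n)^d] / f`. -/
def reducedProj (n : ℕ) (f : Laurent d R) : CyclicModule f →+* ReducedModule n f :=
  Ideal.quotientMap _ (reduceHom n R) (by
    rw [Ideal.span_singleton_le_iff_mem, Ideal.mem_comap]
    exact Ideal.mem_span_singleton_self _)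

theorem reducedProj_surjective (f : Laurent d R) : Function.Surjective (reducedProj n f) :=
  Ideal.quotientMap_surjective reduceHom_surjective

theorem reducedProj_monomialClass (f : Laurent d R) {δ : Fin d → ℤ} (hδ : δ ∈ lattice d n) :
    reducedProj n f (monomialClass f δ) = 1 := by
  have h : reducedProj n f (monomialClass f δ) = Ideal.Quotient.mk _
      (reduceHom n R (AddMonoidAlgebra.single δ 1)) := rfl
  rw [h, reduceHom_single, reduce_eq_zero_iff.2 hδ, ← AddMonoidAlgebra.one_def, map_one]

/-- Pulling back characters of `R[(ℤ/n)^d] / f` to points of `X_f`. -/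
def pullback (n : ℕ) (f : Laurent d R) (ψ : Multiplicative (ReducedModule n f) →* Circle) :
    DualSystem f :=
  { toMonoidHom := ψ.comp (reducedProj n f).toAddMonoidHom.toMultiplicative
    continuous_toFun := continuous_of_discreteTopology }

theorem pullback_apply (f : Laurent d R) (ψ : Multiplicative (ReducedModule n f) →* Circle)
    (m : Multiplicative (CyclicModule f)) :
    pullback n f ψ m = ψ (.ofAdd (reducedProj n f m.toAdd)) := rfl

theorem pullback_injective (f : Laurent d R) : Function.Injective (pullback n f) := by
  refine fun ψ φ h => MonoidHom.ext fun m => ?_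
  obtain ⟨x, hx⟩ := reducedProj_surjective f (Multiplicative.toAdd m)
  have := congrArg (fun χ : DualSystem f => χ (.ofAdd x)) h
  simpa only [pullback_apply, toAdd_ofAdd, hx, ofAdd_toAdd] using this

theorem mem_fixedPoints_iff (f : Laurent d R) (χ : DualSystem f) :
    χ ∈ AddAction.fixedPoints (lattice d n) (DualSystem f) ↔
      ∀ δ ∈ lattice d n, ∀ m : CyclicModule f,
        χ (.ofAdd (monomialClass f δ * m)) = χ (.ofAdd m) :=
  ⟨fun h δ hδ m => congrArg (fun χ : DualSystem f => χ (.ofAdd m)) (h ⟨δ, hδ⟩),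
    fun h δ => PontryaginDual.ext fun m => h δ.1 δ.2 m.toAdd⟩

/-- Invariance under `(nℤ)^d` says that the character of `L_d(R)` depends on exponents only modulo
`n`, so it descends to `R[(ℤ/n)^d]`. -/
theorem range_pullback (f : Laurent d R) :
    Set.range (pullback n f) = AddAction.fixedPoints (lattice d n) (DualSystem f) := by
  ext χ
  rw [mem_fixedPoints_iff]
  constructor
  · rintro ⟨ψ, rfl⟩ δ hδ m
    simp only [pullback_apply, toAdd_ofAdd, map_mul, reducedProj_monomialClass f hδ, one_mul]
  · intro h
    let π : Laurent d R →+ CyclicModule f := (Ideal.Quotient.mk (Ideal.span {f})).toAddMonoidHom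
    let χ₀ : Laurent d R →+ Additive Circle :=
      (MonoidHom.toAdditiveRight (χ : Multiplicative (CyclicModule f) →* Circle)).comp π
    have hχ₀ : ∀ x, χ₀ x = .ofMul (χ (.ofAdd (π x))) := fun x => rfl
    have hinv : ∀ δ ∈ lattice d n, ∀ x, χ₀ (AddMonoidAlgebra.single δ 1 * x) = χ₀ x :=
      fun δ hδ x => by
        rw [hχ₀, hχ₀, ← h δ hδ (π x)]
        congr 3
    -- The descended character is defined on monomials through integer representatives; invariance
    -- makes their choice immaterial.
    let s : (Fin d → ZMod n) → (Fin d → ℤ) := fun g i => (g i).cast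
    let χ₁ : AddMonoidAlgebra R (Fin d → ZMod n) →+ Additive Circle :=
      (Finsupp.liftAddHom fun g => χ₀.comp (AddMonoidAlgebra.singleAddHom (s g))).comp
        AddMonoidAlgebra.coeffAddEquiv.toAddMonoidHom
    have hs : ∀ g a, χ₁ (AddMonoidAlgebra.single g a) = χ₀ (AddMonoidAlgebra.single (s g) a) :=
      fun g a => Finsupp.liftAddHom_apply_single _ g a
    have hχ₁ : ∀ x, χ₁ (reduceHom n R x) = χ₀ x := by
      intro x
      induction x using AddMonoidAlgebra.induction_linear with
      | zero => simp
      | add x y hx hy => simp only [map_add, hx, hy]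
      | single ν a =>
        have hmem : ν - s (reduce d n ν) ∈ lattice d n := by
          rw [← reduce_eq_zero_iff, map_sub, sub_eq_zero]
          ext i
          simp [s, reduce_apply]
        rw [reduceHom_single, hs, ← hinv _ hmem, AddMonoidAlgebra.single_mul_single, one_mul,
          sub_add_cancel]
    have hker : ∀ y ∈ Ideal.span {reduceHom n R f}, χ₁ y = 0 := by
      intro y hy
      obtain ⟨z, rfl⟩ := Ideal.mem_span_singleton'.1 hy
      obtain ⟨x, rfl⟩ := reduceHom_surjective z
      have hx : π (x * f) = 0 :=
        Ideal.Quotient.eq_zero_iff_mem.2 (Ideal.mul_mem_left _ _ (Ideal.mem_span_singleton_self f))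
      rw [← map_mul, hχ₁, hχ₀, hx]
      exact congrArg Additive.ofMul (map_one χ)
    let ψ : ReducedModule n f →+ Additive Circle :=
      QuotientAddGroup.lift (Ideal.span {reduceHom n R f}).toAddSubgroup χ₁ hker
    refine ⟨MonoidHom.toAdditiveRight.symm ψ, PontryaginDual.ext fun m => ?_⟩
    obtain ⟨x, hx⟩ := Ideal.Quotient.mk_surjective (I := Ideal.span {f}) m.toAdd
    have h1 : ψ (reducedProj n f (π x)) = χ₀ x := hχ₁ x
    have hx' : π x = m.toAdd := hx
    rw [hχ₀, hx'] at h1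
    exact congrArg Additive.toMul h1

theorem natCard_monoidHom_circle (G : Type*) [CommGroup G] [Finite G] :
    Nat.card (G →* Circle) = Nat.card G := by
  rw [← CommGroup.card_monoidHom_of_hasEnoughRootsOfUnity G Circle]
  exact Nat.card_congr (MulEquiv.monoidHomCongrRight toUnits).toEquiv

theorem ncard_fixedPoints (f : Laurent d R) [Finite (ReducedModule n f)] :
    (AddAction.fixedPoints (lattice d n) (DualSystem f)).ncard = Nat.card (ReducedModule n f) := by
  rw [← range_pullback, ← Set.image_univ, Set.ncard_image_of_injective _ (pullback_injective f),
    Set.ncard_univ]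
  exact natCard_monoidHom_circle (Multiplicative (ReducedModule n f))

end FixedPoints
theorem index_lattice (d n : ℕ) [NeZero n] : (lattice d n).index = n ^ d := by
  have h : lattice d n = (reduce d n).ker := by
    ext ν
    rw [AddMonoidHom.mem_ker, reduce_eq_zero_iff]
  rw [h, AddSubgroup.index_ker, AddMonoidHom.range_eq_top.2 reduce_surjective]
  simp

/-! ### Comparison of entropy and Mahler measure -/

section Entropy

variable {p : ℕ} [Fact p.Prime] {d : ℕ} {K : Type*} [Field K] [NumberField K]

/-- The periodic points of `X_f` are counted by the values of `N_{K/ℚ}(f)` on `μ_N^d`. -/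
theorem ncard_fixedPoints_eq_natAbs {f : Laurent d (𝓞 K)} {N : ℕ} [NeZero N]
    (h : ∀ ζ ∈ rootsTorus p d N,
      (Laurent.map d (Int.castRingHom ℂ_[p]) (intNorm f)).eval ζ ≠ 0) :
    ∃ a : ℤ, a ≠ 0 ∧
      (AddAction.fixedPoints (lattice d N) (DualSystem f)).ncard = a.natAbs ∧
      (a : ℂ_[p]) = ∏ ζ ∈ rootsTorus p d N,
        (Laurent.map d (Int.castRingHom ℂ_[p]) (intNorm f)).eval ζ := by
  have hcast := intCast_norm_reduceHom (n := N) (F := ℂ_[p]) (intNorm f)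
  rw [← norm_reduceHom_ringOfIntegers] at hcast
  have h0 : Algebra.norm ℤ (reduceHom N (𝓞 K) f) ≠ 0 := fun h0 => by
    rw [h0, Int.cast_zero] at hcast
    exact Finset.prod_ne_zero_iff.2 h hcast.symm
  have : Module.Free (𝓞 K) (AddMonoidAlgebra (𝓞 K) (Fin d → ZMod N)) :=
    .of_basis (AddMonoidAlgebra.basis _ _)
  have : Module.Finite (𝓞 K) (AddMonoidAlgebra (𝓞 K) (Fin d → ZMod N)) :=
    .of_basis (AddMonoidAlgebra.basis _ _)
  have : Module.Free ℤ (AddMonoidAlgebra (𝓞 K) (Fin d → ZMod N)) := .trans (S := 𝓞 K)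
  have : Module.Finite ℤ (AddMonoidAlgebra (𝓞 K) (Fin d → ZMod N)) := .trans (𝓞 K) _
  have hcard := natCard_quotient_span_singleton h0
  have : Finite (ReducedModule N f) :=
    Nat.finite_of_card_ne_zero (by rw [hcard]; exact Int.natAbs_ne_zero.2 h0)
  exact ⟨_, h0, (ncard_fixedPoints f).trans hcard, hcast⟩

theorem log_natAbs {a : ℤ} (ha : a ≠ 0) : log p (a.natAbs : ℂ_[p]) = log p (a : ℂ_[p]) := by
  have hd := LogDomain.intCast (p := p) ha
  have hc : (a.natAbs : ℂ_[p]) = ((a.natAbs : ℤ) : ℂ_[p]) := (Int.cast_natCast _).symm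
  rw [hc]
  rcases Int.natAbs_eq a with h | h
  · rw [← h]
  · have h' : (a.natAbs : ℤ) = -a := by omega
    rw [h', Int.cast_neg, log_neg hd]

/-- The two sequences agree at every `N` prime to `p`, so convergence and the limit transfer
directly. -/
theorem hasEntropy_of_hasMahlerMeasure {f : Laurent d (𝓞 K)} {m : ℂ_[p]}
    (hm : HasMahlerMeasure p d (Laurent.map d (Int.castRingHom ℂ_[p]) (intNorm f)) m)
    (hdom : ∀ N : ℕ, N.Coprime p → ∀ ζ ∈ rootsTorus p d N,
      LogDomain p ((Laurent.map d (Int.castRingHom ℂ_[p]) (intNorm f)).eval ζ)) :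
    HasEntropy p d (DualSystem f) m := by
  have key : ∀ N : ℕ, N.Coprime p →
      (AddAction.fixedPoints (lattice d N) (DualSystem f)).ncard ≠ 0 ∧
      log p ((AddAction.fixedPoints (lattice d N) (DualSystem f)).ncard : ℂ_[p]) =
        ∑ ζ ∈ rootsTorus p d N,
          log p ((Laurent.map d (Int.castRingHom ℂ_[p]) (intNorm f)).eval ζ) := fun N hN => by
    have := neZero_of_coprime hN
    obtain ⟨a, ha, hcard, hprod⟩ := ncard_fixedPoints_eq_natAbs (hm.ne_zero N hN)
    rw [hcard, log_natAbs ha, hprod, log_prod (hdom N hN)]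
    exact ⟨Int.natAbs_ne_zero.2 ha, rfl⟩
  refine ⟨fun N hN => Set.finite_of_ncard_ne_zero (key N hN).1,
    fun N hN => Set.nonempty_of_ncard_ne_zero (key N hN).1, hm.tendsto.congr' ?_⟩
  filter_upwards [mem_inf_of_right (mem_principal_self {N : ℕ | N.Coprime p})] with N hN
  have := neZero_of_coprime hN
  rw [(key N hN).2, index_lattice, Nat.cast_pow]

end Entropy

end PadicEntropy

end

/-- For a number field `K` and `f ∈ L_d(𝓞_K)` such that `N_{K/ℚ}(f)` has no zero on `T_p^d`, the
`p`-adic entropy `h_p(X_f)` and the `p`-adic Mahler measure `m_p(N_{K/ℚ}(f))` exist and agree. -/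
theorem theorem1p4 (p : ℕ) [Fact p.Prime] (d : ℕ) (hd : 0 < d)
    (K : Type*) [Field K] [NumberField K] (f : PadicEntropy.Laurent d (𝓞 K))
    (hf : ∀ z ∈ PadicEntropy.torus p d,
      (PadicEntropy.Laurent.map d (Int.castRingHom ℂ_[p]) (PadicEntropy.intNorm f)).eval z ≠ 0) :
    ∃ h : ℂ_[p],
      PadicEntropy.HasEntropy p d (PadicEntropy.DualSystem f) h ∧
      PadicEntropy.HasMahlerMeasure p d
        (PadicEntropy.Laurent.map d (Int.castRingHom ℂ_[p]) (PadicEntropy.intNorm f)) h := by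
  obtain ⟨m, hm, hdom⟩ := PadicEntropy.exists_hasMahlerMeasure hf
  exact ⟨m, PadicEntropy.hasEntropy_of_hasMahlerMeasure hm hdom, hm⟩
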